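/- **Machines.** An *Oracle-Type-2-Machine* $M$ is a finite directed graph with labelled vertices. It has a unique source, of out-degree $1$, which is the unique vertex labelled $s$. The other vertices of out-degree $1$ carry labels $l_i, r_i$ ($i\in\{0,1,2\}$) or $w_i^b$ ($i\in\{1,2,3\}$, $b\in\{0,1\}$). Vertices of out-degree $2$ (with a first and a second successor) carry labels $t_i$ ($i\in\{0,1,2\}$) or $?$. Sinks carry the labels $a$ or $r$. If the label $?$ does not occur, $M$ is a *Type-2-Machine*. A configuration consists of a vertex, contents $w_0,\dots,w_3\in\{0,1\}^{\mathbb N}$ of four tapes (input, two working tapes, output) and head positions $n_0,\dots,n_3\in\mathbb N$. A step $\to_0$ proceeds from a vertex labelled $s$ to its successor; at $t_i$ to the first or second successor according to whether $w_i[n_i]$ is $0$ or $1$; at $r_i$ and $l_i$ it moves head $i$ by $\pm1$ (no step exists if the position would become negative); at $w_i^b$ it writes $b$ at position $n_i$ of tape $i$ and increases $n_i$ by $1$. There is no step $\to_0$ at vertices labelled $a$, $r$ or $?$. For a step relation $\to$ with reflexive transitive closure $\Rightarrow$, a configuration $c$ *yields* $w\in\{0,1\}^{\mathbb N}$ if either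 $c\Rightarrow c'$ for some $c'$ at a vertex labelled $a$ with output tape content $w$, or if for every $m\ge n_3$ (the output head position in $c$) there is $c^m$ with $c\Rightarrow c^m$ whose output head is at $m$, and the output tape contents of the $c^m$ converge to $w$. Given an oracle $\mathcal O:\subseteq\{0,1\}^{\mathbb N}\rightrightarrows\{0,1\}^{\mathbb N}$, the relation $\to_1$ consists of $\to_0$ together with all *oracle calls*: from a configuration at a vertex labelled $?$, one may pass to its first successor with tape $2$ (the second working tape) replaced by $y$ and its head set to $0$ and everything else unchanged, provided $y\in\mathcal O(x)$ for some $x$ that is yielded, with respect to $\to_0$, by the configuration obtained by moving to the second successor and resetting the output tape to $0^{\mathbb N}$ and its head to $0$. The initial configuration on input $x$ is at $s$, has $x$ on the input tape, $0^{\mathbb N}$ on the other tapes, and all heads at $0$. The values of $M$ on input $x$ with oracle $\mathcal O$ (at query depth $1$) are the sequences yielded by the initial configuration with respect to $\to_1$. A partial function on $\{0,1\}^{\mathbb N}$ is *computable* if it is the function computed in this way by a Type-2-Machine. A function $F(x,y)$ of two arguments is computable if it is computable as a function of the interleaved sequence $\langle x,y\rangle = x(0)y(0)x(1)y(1)\dots$.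 **Single calls.** For partial functions $f,g:\subseteq\{0,1\}^{\mathbb N}\to\{0,1\}^{\mathbb N}$, *$f$ is computable with a single call to an oracle for $g$* if there is an Oracle-Type-2-Machine which, with oracle $g$ and on every input $x\in\operatorname{dom}(f)$, makes exactly one oracle call and has the value $f(x)$. A choice function of a multi-valued partial function $A$ is a partial function that is defined at least on $\operatorname{dom}(A)$ and maps each $x\in\operatorname{dom}(A)$ into $A(x)$. For multi-valued $f,g$, *$f$ is computable with a single call to an oracle for $g$* if there is one Oracle-Type-2-Machine which, for every choice function $\varphi$ of $g$, with oracle $\varphi$ and on every input $x\in\operatorname{dom}(f)$, makes exactly one oracle call and has a value, which lies in $f(x)$. **Weihrauch reducibility.** For partial functions, $f\le_W g$ if there are computable partial functions $F,G$ with $f(w)=F(w,g(G(w)))$ for all $w\in\operatorname{dom}(f)$. For multi-valued partial functions, $A\le_W B$ if there are computable partial functions $F,G$ such that $x\mapsto F(x,g(G(x)))$ is a choice function of $A$ for every choice function $g$ of $B$. **Theorem 5.** Let $f,g$ be both partial functions, or both multi-valued partial functions, on $\{0,1\}^{\mathbb N}$. Then $f$ is computable with a single call to an oracle for $g$ if and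 only if $f\le_W g$. -/

import Mathlib

namespace TypeTwo

/-- Infinite binary sequences, the contents of the tapes. -/
abbrev Cantor : Type := ℕ → Bool

/-- The sequence that is constantly zero. -/
def zeros : Cantor := fun _ => false

/-- The standard pairing `⟨x, y⟩ = x 0, y 0, x 1, y 1, …`. -/
def pair (x y : Cantor) : Cantor :=
  fun n => if n % 2 = 0 then x (n / 2) else y (n / 2)

/-- A partial multi-valued function on Cantor space. It is undefined where it has no value. -/
abbrev MultiFun : Type := Cantor → Set Cantor

/-- The domain of a multi-valued function. -/
def MultiFun.dom (A : MultiFun) : Set Cantor := {x | (A x).Nonempty}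

/-- A partial (single-valued) function, regarded as a multi-valued function. -/
def MultiFun.ofPFun (f : Cantor →. Cantor) : MultiFun := fun x => {y | y ∈ f x}

/-- `φ` is a choice function of `A`: it is defined at least on the domain of `A`, and there it
takes values of `A`. -/
def IsChoice (φ : Cantor →. Cantor) (A : MultiFun) : Prop :=
  ∀ x ∈ A.dom, ∃ y ∈ φ x, y ∈ A x

/-! ### Machines -/

/-- The label of a vertex together with its outgoing edges. The tapes are: `0` input tape,
`1` and `2` working tapes, `3` output tape. The heads of the tapes `0, 1, 2` can be moved and
these tapes can be tested; the tapes `1, 2, 3` can be written on (`write i` writes on tape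
`i + 1`). The two successors of a test are given as a function of the symbol read. -/
inductive Instr (Q : Type) : Type
  | start (S : Q)
  | test (i : Fin 3) (S : Bool → Q)
  | left (i : Fin 3) (S : Q)
  | right (i : Fin 3) (S : Q)
  | write (i : Fin 3) (b : Bool) (S : Q)
  | query (S₀ S₁ : Q)
  | accept
  | reject

/-- The vertices to which the outgoing edges lead. -/
def Instr.targets {Q : Type} : Instr Q → Set Q
  | .start S => {S}
  | .test _ S => Set.range S
  | .left _ S => {S}
  | .right _ S => {S}
  | .write _ _ S => {S}
  | .query S₀ S₁ => {S₀, S₁}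
  | .accept => ∅
  | .reject => ∅

/-- The vertex is labelled `s`. -/
def Instr.IsStart {Q : Type} (I : Instr Q) : Prop := ∃ S, I = .start S

/-- The vertex is labelled `?`. -/
def Instr.IsQuery {Q : Type} (I : Instr Q) : Prop := ∃ S₀ S₁, I = .query S₀ S₁

/-- Oracle-Type-2-Machines: finite labelled graphs with a unique source, which is the unique
vertex labelled `s`. -/
structure OracleMachine where
  /-- the vertices -/
  Q : Type
  [fin : Finite Q]
  /-- labels and edges -/
  instr : Q → Instr Q
  /-- the source -/
  s : Q
  isStart_iff : ∀ v, (instr v).IsStart ↔ v = s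
  isSource_iff : ∀ v, (∀ u, v ∉ (instr u).targets) ↔ v = s

/-- Configurations: a vertex, the contents of the four tapes, the positions of the four heads. -/
structure Config (Q : Type) where
  q : Q
  w : Fin 4 → Cantor
  n : Fin 4 → ℕ

namespace OracleMachine

variable (M : OracleMachine)

/-- Type-2-Machines are the machines in which the label `?` does not occur. -/
def IsType2 : Prop := ∀ v, ¬ (M.instr v).IsQuery

/-- Initial configuration on input `x`. -/
def init (x : Cantor) : Config M.Q where
  q := M.s
  w := Function.update (fun _ => zeros) 0 x
  n := fun _ => 0

/-- Single step transitions of ordinary Type-2-Machines. There is no transition from a vertex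
labelled `?`, and none that would move a head to the left of position `0`. -/
inductive Step : Config M.Q → Config M.Q → Prop
  | start (c : Config M.Q) (S : M.Q) (h : M.instr c.q = .start S) :
      Step c { c with q := S }
  | test (c : Config M.Q) (i : Fin 3) (S : Bool → M.Q) (h : M.instr c.q = .test i S) :
      Step c { c with q := S (c.w i.castSucc (c.n i.castSucc)) }
  | right (c : Config M.Q) (i : Fin 3) (S : M.Q) (h : M.instr c.q = .right i S) :
      Step c { c with q := S, n := Function.update c.n i.castSucc (c.n i.castSucc + 1) }
  | left (c : Config M.Q) (i : Fin 3) (S : M.Q) (h : M.instr c.q = .left i S)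
      (hn : c.n i.castSucc ≠ 0) :
      Step c { c with q := S, n := Function.update c.n i.castSucc (c.n i.castSucc - 1) }
  | write (c : Config M.Q) (i : Fin 3) (b : Bool) (S : M.Q) (h : M.instr c.q = .write i b S) :
      Step c
        { q := S
          w := Function.update c.w i.succ (Function.update (c.w i.succ) (c.n i.succ) b)
          n := Function.update c.n i.succ (c.n i.succ + 1) }

/-- The configuration `c` yields the output `w`, given the relation `T` of arbitrary (multi-step)
transitions: either by finite computation (a vertex labelled `a` is reached) or by infinite
computation (the output head reaches every position, and the contents of the output tape
converge to `w`). -/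
def Yields (T : Config M.Q → Config M.Q → Prop) (c : Config M.Q) (w : Cantor) : Prop :=
  (∃ c', T c c' ∧ M.instr c'.q = .accept ∧ c'.w 3 = w) ∨
  (∃ d : ℕ → Config M.Q, (∀ m, c.n 3 ≤ m → T c (d m) ∧ (d m).n 3 = m) ∧
    Filter.Tendsto (fun m => (d m).w 3) Filter.atTop (nhds w))

/-- The configuration in which the query asked in `c` is computed: the computation starts in
`S₁`, with erased output tape. -/
def queryConfig (c : Config M.Q) (S₁ : M.Q) : Config M.Q where
  q := S₁
  w := Function.update c.w 3 zeros
  n := Function.update c.n 3 0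

/-- The configuration after the query asked in `c` was answered by `y`: the computation continues
in `S₀`, with `y` on the second working tape. -/
def answerConfig (c : Config M.Q) (S₀ : M.Q) (y : Cantor) : Config M.Q where
  q := S₀
  w := Function.update c.w 2 y
  n := Function.update c.n 2 0

/-- Single step transitions with oracle `O` and query depth `n`. -/
def OStep (O : MultiFun) : ℕ → Config M.Q → Config M.Q → Prop
  | 0 => M.Step
  | n + 1 => fun c c' => OStep O n c c' ∨
      ∃ S₀ S₁ x y, M.instr c.q = .query S₀ S₁ ∧
        M.Yields (Relation.ReflTransGen (OStep O n)) (M.queryConfig c S₁) x ∧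
        y ∈ O x ∧ c' = M.answerConfig c S₀ y

/-- The multi-valued function computed by `M` with oracle `O` and query depth `n`. -/
def eval (O : MultiFun) (n : ℕ) : MultiFun :=
  fun x => {y | M.Yields (Relation.ReflTransGen (M.OStep O n)) (M.init x) y}

/-- `M.Run O n c k d`: with oracle `O` and query depth `n`, the configuration `d` is reached from
`c` by a run that makes exactly `k` oracle calls (not counting calls nested in calls). -/
inductive Run (O : MultiFun) (n : ℕ) (c : Config M.Q) : ℕ → Config M.Q → Prop
  | refl : Run O n c 0 c
  | step {k : ℕ} {d e : Config M.Q} (hr : Run O n c k d) (hq : ¬ (M.instr d.q).IsQuery)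
      (hs : M.OStep O n d e) : Run O n c k e
  | call {k : ℕ} {d e : Config M.Q} (hr : Run O n c k d) (hq : (M.instr d.q).IsQuery)
      (hs : M.OStep O n d e) : Run O n c (k + 1) e

/-- On input `x`, with oracle `O` and query depth `1`, the machine makes a single oracle call. -/
def MakesSingleCall (O : MultiFun) (x : Cantor) : Prop :=
  (∃ d, M.Run O 1 (M.init x) 1 d) ∧ ∀ k d, M.Run O 1 (M.init x) k d → k ≤ 1

/-- `M` solves `A` with a single call to the oracle `O`: on every input in the domain of `A` it
makes a single call, has an output, and the output is a value of `A`. -/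
def SolvesWithSingleCall (O : MultiFun) (A : MultiFun) : Prop :=
  ∀ x ∈ A.dom, M.MakesSingleCall O x ∧ (M.eval O 1 x).Nonempty ∧ M.eval O 1 x ⊆ A x

end OracleMachine

/-! ### Computability and reducibility -/

/-- `F` is the partial function computed by some ordinary Type-2-Machine. -/
def ComputablePFun (F : Cantor →. Cantor) : Prop :=
  ∃ M : OracleMachine, M.IsType2 ∧
    ∀ x y, y ∈ F x ↔ M.Yields (Relation.ReflTransGen M.Step) (M.init x) y

/-- The partial function `x ↦ F (x, g (G x))`. -/
def compose (F g G : Cantor →. Cantor) : Cantor →. Cantor :=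
  fun x => (G x).bind fun z => (g z).bind fun y => F (pair x y)

/-- Computable Weihrauch reducibility of multi-valued functions: there are computable `F` and `G`
such that `x ↦ F (x, g (G x))` is a choice function of `A` for every choice function `g`
of `B`. -/
def WeihrauchLE (A B : MultiFun) : Prop :=
  ∃ F G : Cantor →. Cantor, ComputablePFun F ∧ ComputablePFun G ∧
    ∀ g, IsChoice g B → IsChoice (compose F g G) A

/-- Computable Weihrauch reducibility of (single-valued) partial functions: there are computable
`F` and `G` with `f w = F (w, g (G w))` for all `w` in the domain of `f`. -/
def WeihrauchLEFun (f g : Cantor →. Cantor) : Prop :=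
  ∃ F G : Cantor →. Cantor, ComputablePFun F ∧ ComputablePFun G ∧
    ∀ w ∈ f.Dom, f w = compose F g G w

/-- The multi-valued function `f` is computable with a single call to an oracle for `g`: one
machine computes, from every choice function of `g` as its oracle, a choice function of `f`. -/
def ComputableWithSingleCall (f g : MultiFun) : Prop :=
  ∃ M : OracleMachine, ∀ φ, IsChoice φ g → M.SolvesWithSingleCall (MultiFun.ofPFun φ) f

/-- The (single-valued) partial function `f` is computable with a single call to the
oracle `g`. -/
def ComputableWithSingleCallFun (f g : Cantor →. Cantor) : Prop :=
  ∃ M : OracleMachine, M.SolvesWithSingleCall (MultiFun.ofPFun g) (MultiFun.ofPFun f)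

end TypeTwo

/-! A single call cuts a computation into a query and a continuation. From a machine `M` one obtains
`G` by running `M` up to the call with its output suppressed, and then its query computation
(`queryMachine`). One obtains `F` by replaying `M` on `x` from the beginning, with the call replaced
by the given answer `y` (`resumeMachine`); the replay also reproduces what `M` wrote before the
call. Conversely, given `F` and `G`, a machine calls the oracle at once, with `G` as the query
computation, and then runs `F` (`reductionMachine`).

The obstacle is the number of tapes. The replay must keep `y` intact while both working tapes may be
in use before the call; in the converse, `F` expects `⟨x, y⟩` on its input tape, whereas `y` stands
on the second working tape. Both tasks are programs with four two-way tapes, two of which initially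
hold `x` and `y`. `merge_yields` turns the four tapes and their heads into tracks of a single tape.
Its cells are loaded with symbols of `x` and `y` only when first visited, since infinite arguments
cannot be copied in advance. `block_yields` codes each cell by ten cells of the first working tape.
The arguments are now read just once from left to right, so they may be interleaved or stand on
separate tapes.

Forward simulations suffice throughout (`OutputSystem.Yields.of_sim`): with a single-valued oracle
the machines are deterministic and have at most one output (`OutputSystem.Yields.unique`). As the
constructions do not depend on the oracle, `exists_reduction_of_machine` and
`exists_machine_of_reduction` serve the single-valued and the multi-valued case alike. -/

namespace TypeTwo

open Relation Filter

/-! ### Transition systems with a one-way output tape -/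

/-- A transition system with accepting states and a one-way output tape. -/
structure OutputSystem where
  /-- the states -/
  C : Type
  /-- single steps -/
  Step : C → C → Prop
  /-- the accepting states -/
  Acc : C → Prop
  /-- the content of the output tape -/
  tape : C → Cantor
  /-- the position of the output head -/
  head : C → ℕ

namespace OutputSystem

/-- The state `c` yields the output `w`, by a finite or an infinite computation. -/
def Yields (A : OutputSystem) (c : A.C) (w : Cantor) : Prop :=
  (∃ c', ReflTransGen A.Step c c' ∧ A.Acc c' ∧ A.tape c' = w) ∨
  (∃ d : ℕ → A.C, (∀ m, A.head c ≤ m → ReflTransGen A.Step c (d m) ∧ A.head (d m) = m) ∧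
    Tendsto (fun m => A.tape (d m)) atTop (nhds w))

variable {A B : OutputSystem}

/-- A forward simulation that respects multi-step transitions. -/
theorem exists_reflTransGen_of_sim (R : A.C → B.C → Prop)
    (hstep : ∀ c c' d, R c d → A.Step c c' → ∃ d', ReflTransGen B.Step d d' ∧ R c' d')
    {c c' : A.C} {d : B.C} (h : R c d) (hc : ReflTransGen A.Step c c') :
    ∃ d', ReflTransGen B.Step d d' ∧ R c' d' := by
  induction hc with
  | refl => exact ⟨d, .refl, h⟩
  | tail _ hs ih =>
    obtain ⟨d₁, h₁, hR⟩ := ih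
    obtain ⟨d₂, h₂, hR'⟩ := hstep _ _ _ hR hs
    exact ⟨d₂, h₁.trans h₂, hR'⟩

/-- Forward simulations preserve outputs. -/
theorem Yields.of_sim (R : A.C → B.C → Prop)
    (hstep : ∀ c c' d, R c d → A.Step c c' → ∃ d', ReflTransGen B.Step d d' ∧ R c' d')
    (hacc : ∀ c d, R c d → A.Acc c → B.Acc d)
    (htape : ∀ c d, R c d → B.tape d = A.tape c)
    (hhead : ∀ c d, R c d → B.head d = A.head c)
    {c : A.C} {d : B.C} {w : Cantor} (h : R c d) (hc : A.Yields c w) : B.Yields d w := by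
  rcases hc with ⟨c', hc', ha, rfl⟩ | ⟨f, hf, hlim⟩
  · obtain ⟨d', hd', hR⟩ := exists_reflTransGen_of_sim R hstep h hc'
    exact .inl ⟨d', hd', hacc _ _ hR ha, htape _ _ hR⟩
  · have key : ∀ m, ∃ d', A.head c ≤ m →
        ReflTransGen B.Step d d' ∧ R (f m) d' := fun m => by
      by_cases hm : A.head c ≤ m
      · obtain ⟨d', h₁, h₂⟩ := exists_reflTransGen_of_sim R hstep h (hf m hm).1
        exact ⟨d', fun _ => ⟨h₁, h₂⟩⟩
      · exact ⟨d, fun h => absurd h hm⟩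
    choose g hg using key
    refine .inr ⟨g, fun m hm => ?_, hlim.congr' ?_⟩
    · rw [hhead _ _ h] at hm
      exact ⟨(hg m hm).1, (hhead _ _ (hg m hm).2).trans (hf m hm).2⟩
    · filter_upwards [eventually_ge_atTop (A.head c)] with m hm
      exact (htape _ _ (hg m hm).2).symm

/-- Computation steps before the first output do not matter. -/
theorem Yields.of_reflTransGen {c c' : A.C} {w : Cantor} (h : ReflTransGen A.Step c c')
    (hh : A.head c' ≤ A.head c) (hc : A.Yields c' w) : A.Yields c w := by
  rcases hc with ⟨e, he, ha⟩ | ⟨f, hf, hlim⟩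
  · exact .inl ⟨e, h.trans he, ha⟩
  · exact .inr ⟨f, fun m hm => ⟨h.trans (hf m (hh.trans hm)).1, (hf m (hh.trans hm)).2⟩, hlim⟩

/-- A deterministic system has at most one output. -/
theorem Yields.unique (hdet : Relator.RightUnique A.Step)
    (hacc : ∀ c c', A.Acc c → ¬ A.Step c c')
    (hhead : ∀ c c', A.Step c c' → A.head c ≤ A.head c')
    (htape : ∀ c c', A.Step c c' → A.head c = A.head c' → A.tape c = A.tape c')
    {c : A.C} {v w : Cantor} (hv : A.Yields c v) (hw : A.Yields c w) : v = w := by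
  -- The output head never moves back, and the tape cannot change while it stands still.
  have mono : ∀ {a b}, ReflTransGen A.Step a b →
      A.head a ≤ A.head b ∧ (A.head a = A.head b → A.tape a = A.tape b) := fun h => by
    induction h with
    | refl => exact ⟨le_rfl, fun _ => rfl⟩
    | tail _ hs ih =>
      have h₁ := hhead _ _ hs
      refine ⟨ih.1.trans h₁, fun he => ?_⟩
      have h₂ := ih.1
      exact (ih.2 (by omega)).trans (htape _ _ hs (by omega))
  have stuck : ∀ {a b}, A.Acc a → ReflTransGen A.Step a b → b = a := fun ha h => by
    rcases h.cases_head with h | ⟨_, h, _⟩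
    · exact h.symm
    · exact absurd h (hacc _ _ ha)
  -- An accepting state is terminal, while an infinite computation moves the head beyond the
  -- position reached there.
  have mixed : ∀ {v w : Cantor}, (∃ c', ReflTransGen A.Step c c' ∧ A.Acc c' ∧ A.tape c' = v) →
      (∃ d : ℕ → A.C, (∀ m, A.head c ≤ m → ReflTransGen A.Step c (d m) ∧ A.head (d m) = m) ∧
        Tendsto (fun m => A.tape (d m)) atTop (nhds w)) → False := by
    rintro v w ⟨a, ha, haa, -⟩ ⟨f, hf, -⟩
    obtain ⟨h₁, h₂⟩ := hf (A.head a + 1) ((mono ha).1.trans (Nat.le_succ _))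
    rcases ReflTransGen.total_of_right_unique hdet ha h₁ with h | h
    · rw [stuck haa h] at h₂
      omega
    · have := (mono h).1
      omega
  rcases hv with hv | hv <;> rcases hw with hw | hw
  · obtain ⟨a, ha, haa, rfl⟩ := hv
    obtain ⟨b, hb, hbb, rfl⟩ := hw
    rcases ReflTransGen.total_of_right_unique hdet ha hb with h | h
    · rw [stuck haa h]
    · rw [stuck hbb h]
  · exact (mixed hv hw).elim
  · exact (mixed hw hv).elim
  · obtain ⟨f, hf, hfl⟩ := hv
    obtain ⟨g, hg, hgl⟩ := hw
    -- By determinism `f m` and `g m` lie on one run; their heads agree, hence so do their tapes.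
    refine tendsto_nhds_unique hfl (hgl.congr' ?_)
    filter_upwards [eventually_ge_atTop (A.head c)] with m hm
    have he : A.head (f m) = A.head (g m) := (hf m hm).2.trans (hg m hm).2.symm
    rcases ReflTransGen.total_of_right_unique hdet (hf m hm).1 (hg m hm).1 with h | h
    · exact ((mono h).2 he).symm
    · exact (mono h).2 he.symm

end OutputSystem

/-! ### Machines as transition systems -/

namespace OracleMachine

/-- A machine with the step relation `r` as a transition system. -/
def system (M : OracleMachine) (r : Config M.Q → Config M.Q → Prop) : OutputSystem where
  C := Config M.Q
  Step := r
  Acc c := M.instr c.q = .accept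
  tape c := c.w 3
  head c := c.n 3

theorem Step.right_unique (M : OracleMachine) : Relator.RightUnique M.Step := by
  intro a b c hb hc
  cases hb <;> cases hc <;> simp_all

theorem Step.head_le {M : OracleMachine} {c c' : Config M.Q} (h : M.Step c c') :
    c.n 3 ≤ c'.n 3 := by
  cases h with
  | write i b S h => fin_cases i <;> simp [Function.update]
  | right i S h => fin_cases i <;> simp [Function.update]
  | left i S h => fin_cases i <;> simp [Function.update]
  | _ => exact le_rfl

/-- Only `write 2` touches the output tape, and it advances the head. -/
theorem Step.tape_eq {M : OracleMachine} {c c' : Config M.Q} (h : M.Step c c')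
    (hn : c.n 3 = c'.n 3) : c.w 3 = c'.w 3 := by
  cases h with
  | write i b S h => fin_cases i <;> simp [Function.update] at hn ⊢
  | _ => rfl

theorem Step.not_accept {M : OracleMachine} {c c' : Config M.Q} (h : M.Step c c') :
    M.instr c.q ≠ .accept := by
  cases h <;> simp_all

theorem Step.mem_targets {M : OracleMachine} {c c' : Config M.Q} (h : M.Step c c') :
    c'.q ∈ (M.instr c.q).targets := by
  cases h with
  | test i S h => exact h ▸ Set.mem_range_self _
  | _ => simp_all [Instr.targets]

theorem Step.not_query {M : OracleMachine} {c c' : Config M.Q} (h : M.Step c c') :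
    ¬ (M.instr c.q).IsQuery := by
  rintro ⟨_, _, hq⟩
  cases h <;> simp_all

theorem yields_step_unique {M : OracleMachine} {c : Config M.Q} {v w : Cantor}
    (hv : M.Yields (ReflTransGen M.Step) c v) (hw : M.Yields (ReflTransGen M.Step) c w) :
    v = w :=
  OutputSystem.Yields.unique (A := M.system M.Step) (Step.right_unique M)
    (fun _ _ ha h => h.not_accept ha) (fun _ _ h => h.head_le) (fun _ _ h => h.tape_eq) hv hw

/-! ### Oracle steps and runs at query depth one -/

theorem oStep_one_iff {M : OracleMachine} {O : MultiFun} {c c' : Config M.Q} :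
    M.OStep O 1 c c' ↔ M.Step c c' ∨ ∃ S₀ S₁ x y, M.instr c.q = .query S₀ S₁ ∧
      M.Yields (ReflTransGen M.Step) (M.queryConfig c S₁) x ∧
        y ∈ O x ∧ c' = M.answerConfig c S₀ y := Iff.rfl

/-- Ordinary steps never leave a query vertex. At such a vertex the query is unique by
`yields_step_unique`, and the answer because `φ` is single-valued. -/
theorem oStep_right_unique (M : OracleMachine) (φ : Cantor →. Cantor) :
    Relator.RightUnique (M.OStep (MultiFun.ofPFun φ) 1) := by
  intro a b c hb hc
  rcases oStep_one_iff.1 hb with hb | ⟨S₀, S₁, x, y, hi, hx, hy, rfl⟩ <;>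
  rcases oStep_one_iff.1 hc with hc | ⟨T₀, T₁, x', y', hi', hx', hy', rfl⟩
  · exact Step.right_unique M hb hc
  · exact absurd ⟨_, _, hi'⟩ hb.not_query
  · exact absurd ⟨_, _, hi⟩ hc.not_query
  · obtain ⟨rfl, rfl⟩ : S₀ = T₀ ∧ S₁ = T₁ := by simpa [hi] using hi'
    obtain rfl := yields_step_unique hx hx'
    rw [Part.mem_unique hy hy']

/-- With a single-valued oracle a machine has at most one output. -/
theorem eval_unique {M : OracleMachine} {φ : Cantor →. Cantor} {x v w : Cantor}
    (hv : v ∈ M.eval (MultiFun.ofPFun φ) 1 x) (hw : w ∈ M.eval (MultiFun.ofPFun φ) 1 x) :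
    v = w := by
  refine OutputSystem.Yields.unique (A := M.system (M.OStep (MultiFun.ofPFun φ) 1))
    (oStep_right_unique M φ) (fun c c' ha h => ?_) (fun c c' h => ?_) (fun c c' h => ?_) hv hw
  · replace ha : M.instr c.q = .accept := ha
    rcases oStep_one_iff.1 h with h | ⟨S₀, S₁, x, y, hi, -⟩
    · exact h.not_accept ha
    · simp [ha] at hi
  · rcases oStep_one_iff.1 h with h | ⟨S₀, S₁, x, y, hi, -, -, rfl⟩
    · exact h.head_le
    · simp [system, answerConfig]
  · rcases oStep_one_iff.1 h with h | ⟨S₀, S₁, x, y, hi, -, -, rfl⟩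
    · exact h.tape_eq
    · simp [system, answerConfig]

/-- A run without oracle calls consists of ordinary steps. -/
theorem Run.reflTransGen {M : OracleMachine} {O : MultiFun} {c d : Config M.Q}
    (h : M.Run O 1 c 0 d) : ReflTransGen M.Step c d := by
  generalize hk : 0 = k at h
  induction h with
  | refl => exact .refl
  | step hr hq hs ih =>
    rcases oStep_one_iff.1 hs with hs | ⟨S₀, S₁, _, _, hi, -⟩
    · exact (ih hk).tail hs
    · exact absurd ⟨S₀, S₁, hi⟩ hq
  | call => exact absurd hk (Nat.succ_ne_zero _).symm

/-- A run with an oracle call has a first oracle call. -/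
theorem Run.exists_call {M : OracleMachine} {O : MultiFun} {c d : Config M.Q}
    (h : M.Run O 1 c 1 d) : ∃ d₀ S₀ S₁ x y, M.Run O 1 c 0 d₀ ∧ M.instr d₀.q = .query S₀ S₁ ∧
      M.Yields (ReflTransGen M.Step) (M.queryConfig d₀ S₁) x ∧ y ∈ O x := by
  suffices ∀ k d, M.Run O 1 c k d → k = 1 → _ from this 1 d h rfl
  intro k d h hk
  induction h with
  | refl => simp at hk
  | step _ _ _ ih => exact ih hk
  | call hr hq hs =>
    rcases oStep_one_iff.1 hs with hs | ⟨S₀, S₁, x, y, hi, hx, hy, -⟩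
    · exact absurd hq hs.not_query
    · obtain rfl := Nat.succ_injective hk
      exact ⟨_, S₀, S₁, x, y, hr, hi, hx, hy⟩

/-! ### Partial functions computed without an oracle -/

open Classical in
/-- The partial function computed by a machine without oracle. -/
noncomputable def pfun (M : OracleMachine) : Cantor →. Cantor := fun x =>
  ⟨∃ y, M.Yields (ReflTransGen M.Step) (M.init x) y, fun h => h.choose⟩

/-- Uniqueness of outputs makes the arbitrary choice in `pfun` harmless. -/
theorem mem_pfun {M : OracleMachine} {x y : Cantor} :
    y ∈ M.pfun x ↔ M.Yields (ReflTransGen M.Step) (M.init x) y :=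
  ⟨fun ⟨h, he⟩ => he ▸ h.choose_spec,
    fun h => ⟨⟨y, h⟩, yields_step_unique (Exists.choose_spec ⟨y, h⟩) h⟩⟩

theorem computablePFun_pfun {M : OracleMachine} (hM : M.IsType2) : ComputablePFun M.pfun :=
  ⟨M, hM, fun _ _ => mem_pfun⟩

end OracleMachine

/-! ### Renaming of vertices, and machines from arbitrary instruction tables -/

/-- Renaming of the vertices. The label `s` is replaced by a test with equal successors. -/
def Instr.embed {Q Q' : Type} (e : Q → Q') : Instr Q → Instr Q'
  | .start S => .test 0 fun _ => e S
  | .test i S => .test i fun b => e (S b)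
  | .left i S => .left i (e S)
  | .right i S => .right i (e S)
  | .write i b S => .write i b (e S)
  | .query S₀ S₁ => .query (e S₀) (e S₁)
  | .accept => .accept
  | .reject => .reject

theorem Instr.not_isStart_embed {Q Q' : Type} (e : Q → Q') (I : Instr Q) :
    ¬ (I.embed e).IsStart := by
  rintro ⟨S, h⟩
  cases I <;> simp [embed] at h

theorem Instr.isQuery_embed {Q Q' : Type} {e : Q → Q'} {I : Instr Q} :
    (I.embed e).IsQuery ↔ I.IsQuery := by
  cases I <;> simp [embed, IsQuery]

theorem Instr.targets_embed_subset {Q Q' : Type} (e : Q → Q') (I : Instr Q) :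
    (I.embed e).targets ⊆ Set.range e := by
  cases I <;> simp [embed, targets, Set.insert_subset_iff]

theorem Instr.embed_embed {Q Q' Q'' : Type} (e : Q → Q') (e' : Q' → Q'') (I : Instr Q) :
    (I.embed e).embed e' = I.embed fun q => e' (e q) := by
  cases I <;> rfl

/-- Renaming of the vertex of a configuration. -/
def Config.map {Q Q' : Type} (e : Q → Q') (c : Config Q) : Config Q' := ⟨e c.q, c.w, c.n⟩

/-- A machine simulates the steps of every machine embedded in it. -/
theorem OracleMachine.Step.map {M M' : OracleMachine} {e : M.Q → M'.Q} {c c' : Config M.Q}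
    (he : M'.instr (e c.q) = (M.instr c.q).embed e) (h : M.Step c c') :
    M'.Step (c.map e) (c'.map e) := by
  cases h with
  | start S h => rw [h] at he; exact Step.test (c.map e) 0 (fun _ => e S) he
  | test i S h => rw [h] at he; exact Step.test (c.map e) i (fun b => e (S b)) he
  | right i S h => rw [h] at he; exact Step.right (c.map e) i (e S) he
  | left i S h hn => rw [h] at he; exact Step.left (c.map e) i (e S) he hn
  | write i b S h => rw [h] at he; exact Step.write (c.map e) i b (e S) he

/-- Query vertices are exempt from `he`: they neither accept nor have ordinary steps, so `M'` may
treat them in any way. -/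
theorem OracleMachine.Yields.map {M M' : OracleMachine} {e : M.Q → M'.Q} {c : Config M.Q}
    (he : ∀ q, ¬ (M.instr q).IsQuery → M'.instr (e q) = (M.instr q).embed e) {w : Cantor}
    (h : M.Yields (ReflTransGen M.Step) c w) :
    M'.Yields (ReflTransGen M'.Step) (c.map e) w := by
  refine OutputSystem.Yields.of_sim (A := M.system M.Step) (B := M'.system M'.Step)
    (fun c d => d = c.map e) ?_ ?_ ?_ ?_ rfl h
  · rintro c c' _ rfl hs
    exact ⟨_, .single (hs.map (he c.q hs.not_query)), rfl⟩
  · rintro c _ rfl ha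
    replace ha : M.instr c.q = .accept := ha
    refine (he c.q ?_).trans (congrArg (Instr.embed e) ha)
    simp [ha, Instr.IsQuery]
  · rintro c _ rfl
    rfl
  · rintro c _ rfl
    rfl

/-- The vertices of the machine with a given instruction table: a source, the given vertices,
and for each of these an auxiliary vertex that leads to it. -/
inductive Node (Q : Type) : Type
  | source
  | node (q : Q)
  | feed (q : Q)

instance (Q : Type) [Finite Q] : Finite (Node Q) :=
  Finite.of_surjective (fun o : Option (Q ⊕ Q) => match o with
    | none => Node.source
    | some (.inl q) => Node.node q
    | some (.inr q) => Node.feed q) (by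
      rintro (_ | q | q)
      exacts [⟨none, rfl⟩, ⟨some (.inl q), rfl⟩, ⟨some (.inr q), rfl⟩])

/-- The machine with a given instruction table, started at a given vertex. -/
def ofTable {Q : Type} [Finite Q] (instr : Q → Instr Q) (q₀ : Q) : OracleMachine where
  Q := Node Q
  instr
    | .source => .start (.node q₀)
    | .node q => (instr q).embed .node
    -- Every vertex except the source needs an incoming edge: one successor provides it for `node
    -- q`, the self-loop for `feed q`.
    | .feed q => .test 0 fun b => if b then .node q else .feed q
  s := .source
  isStart_iff
    | .source => by simp [Instr.IsStart]
    | .node q => by simpa using Instr.not_isStart_embed _ _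
    | .feed q => by simp [Instr.IsStart]
  isSource_iff
    | .source => by
      refine iff_of_true (fun u hu => ?_) rfl
      cases u with
      | source => simp [Instr.targets] at hu
      | node q => obtain ⟨_, h⟩ := Instr.targets_embed_subset _ _ hu; cases h
      | feed q =>
        obtain ⟨b, h⟩ := hu
        cases b <;> cases h
    | .node q => iff_of_false (fun h => h (.feed q) ⟨true, rfl⟩) nofun
    | .feed q => iff_of_false (fun h => h (.feed q) ⟨false, rfl⟩) nofun

theorem ofTable_isType2 {Q : Type} [Finite Q] {instr : Q → Instr Q} (q₀ : Q)
    (h : ∀ q, ¬ (instr q).IsQuery) : (ofTable instr q₀).IsType2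
  | .source => by simp [ofTable, Instr.IsQuery]
  | .node q => fun hq => h q (Instr.isQuery_embed.1 hq)
  | .feed q => by simp [ofTable, Instr.IsQuery]

theorem ofTable_step_source {Q : Type} [Finite Q] (instr : Q → Instr Q) (q₀ : Q)
    (w : Fin 4 → Cantor) (n : Fin 4 → ℕ) :
    (ofTable instr q₀).Step ⟨.source, w, n⟩ ⟨.node q₀, w, n⟩ :=
  .start _ _ rfl

/-! ### Programs with four two-way tapes

All four tapes can be read and written; two of them contain the arguments at the beginning. -/

/-- The instructions of four-tape programs. -/
inductive FourInstr (σ : Type) : Type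
  | test (i : Fin 4) (S : Bool → σ)
  | left (i : Fin 4) (S : σ)
  | right (i : Fin 4) (S : σ)
  | write (i : Fin 4) (b : Bool) (S : σ)
  | out (b : Bool) (S : σ)
  | accept
  | reject

/-- The configurations of four-tape programs: state, tapes, heads, output tape, output head. -/
structure FourConfig (σ : Type) where
  q : σ
  w : Fin 4 → Cantor
  n : Fin 4 → ℕ
  o : Cantor
  m : ℕ

/-- The steps of a four-tape program. -/
inductive FourStep {σ : Type} (P : σ → FourInstr σ) : FourConfig σ → FourConfig σ → Prop
  | test (c : FourConfig σ) (i : Fin 4) (S : Bool → σ) (h : P c.q = .test i S) :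
      FourStep P c { c with q := S (c.w i (c.n i)) }
  | right (c : FourConfig σ) (i : Fin 4) (S : σ) (h : P c.q = .right i S) :
      FourStep P c { c with q := S, n := Function.update c.n i (c.n i + 1) }
  | left (c : FourConfig σ) (i : Fin 4) (S : σ) (h : P c.q = .left i S) (hn : c.n i ≠ 0) :
      FourStep P c { c with q := S, n := Function.update c.n i (c.n i - 1) }
  | write (c : FourConfig σ) (i : Fin 4) (b : Bool) (S : σ) (h : P c.q = .write i b S) :
      FourStep P c { c with
        q := S
        w := Function.update c.w i (Function.update (c.w i) (c.n i) b)
        n := Function.update c.n i (c.n i + 1) }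
  | out (c : FourConfig σ) (b : Bool) (S : σ) (h : P c.q = .out b S) :
      FourStep P c { c with q := S, o := Function.update c.o c.m b, m := c.m + 1 }

/-- A four-tape program as a transition system. -/
def fourSystem {σ : Type} (P : σ → FourInstr σ) : OutputSystem where
  C := FourConfig σ
  Step := FourStep P
  Acc c := P c.q = .accept
  tape c := c.o
  head c := c.m

/-- The tapes of a four-tape program at the beginning. -/
def fourTapes (x y : Cantor) : Fin 4 → Cantor := ![x, zeros, zeros, y]

/-- The initial configuration of a four-tape program. -/
def FourConfig.init {σ : Type} (q : σ) (x y : Cantor) : FourConfig σ :=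
  ⟨q, fourTapes x y, fun _ => 0, zeros, 0⟩

/-! ### Programs with one multi-track tape -/

/-- The tracks of the tape: a mark for the cells that have been initialized, a mark for the
leftmost cell, and the contents and the head positions of four tapes. -/
inductive Track : Type
  | loaded
  | first
  | bit (i : Fin 4)
  | mark (i : Fin 4)
  deriving DecidableEq

/-- The instructions of multi-track programs. The instruction `input` reads the next symbols of
the two arguments. -/
inductive TrackInstr (σ : Type) : Type
  | test (t : Track) (S : Bool → σ)
  | set (t : Track) (b : Bool) (S : σ)
  | left (S : σ)
  | right (S : σ)
  | input (S : Bool → Bool → σ)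
  | out (b : Bool) (S : σ)
  | accept
  | reject

/-- The configurations of multi-track programs: state, tape, head, number of symbols of the
arguments that have been read, output tape, output head. -/
structure TrackConfig (σ : Type) where
  q : σ
  T : ℕ → Track → Bool
  p : ℕ
  k : ℕ
  o : Cantor
  m : ℕ

/-- Change one symbol of a multi-track tape. -/
def setTrack (T : ℕ → Track → Bool) (p : ℕ) (t : Track) (b : Bool) : ℕ → Track → Bool :=
  fun p' t' => if p' = p ∧ t' = t then b else T p' t'

/-- The steps of a multi-track program with arguments `x` and `y`. -/
inductive TrackStep {σ : Type} (P : σ → TrackInstr σ) (x y : Cantor) :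
    TrackConfig σ → TrackConfig σ → Prop
  | test (c : TrackConfig σ) (t : Track) (S : Bool → σ) (h : P c.q = .test t S) :
      TrackStep P x y c { c with q := S (c.T c.p t) }
  | set (c : TrackConfig σ) (t : Track) (b : Bool) (S : σ) (h : P c.q = .set t b S) :
      TrackStep P x y c { c with q := S, T := setTrack c.T c.p t b }
  | right (c : TrackConfig σ) (S : σ) (h : P c.q = .right S) :
      TrackStep P x y c { c with q := S, p := c.p + 1 }
  | left (c : TrackConfig σ) (S : σ) (h : P c.q = .left S) (hp : c.p ≠ 0) :
      TrackStep P x y c { c with q := S, p := c.p - 1 }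
  | input (c : TrackConfig σ) (S : Bool → Bool → σ) (h : P c.q = .input S) :
      TrackStep P x y c { c with q := S (x c.k) (y c.k), k := c.k + 1 }
  | out (c : TrackConfig σ) (b : Bool) (S : σ) (h : P c.q = .out b S) :
      TrackStep P x y c { c with q := S, o := Function.update c.o c.m b, m := c.m + 1 }

/-- A multi-track program as a transition system. -/
def trackSystem {σ : Type} (P : σ → TrackInstr σ) (x y : Cantor) : OutputSystem where
  C := TrackConfig σ
  Step := TrackStep P x y
  Acc c := P c.q = .accept
  tape c := c.o
  head c := c.m

/-- The initial configuration of a multi-track program. -/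
def TrackConfig.init {σ : Type} (q : σ) : TrackConfig σ :=
  ⟨q, fun _ _ => false, 0, 0, zeros, 0⟩

/-! ### Simulation of four tapes on one multi-track tape -/

/-- The states of the simulation. -/
inductive MergeState (σ : Type) : Type
  | boot (n : Fin 9) (a b : Bool)
  | seek (q : σ)
  | next (q : σ)
  | act (q : σ)
  | liftR (i : Fin 4) (S : σ)
  | stepR (i : Fin 4) (S : σ)
  | place (i : Fin 4) (S : σ)
  | load (n : Fin 4) (i : Fin 4) (S : σ) (a b : Bool)
  | stepL (i : Fin 4) (S : σ)
  | drop (i : Fin 4) (S : σ)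
  | ret (S : σ)
  | back (S : σ)

instance (σ : Type) [Finite σ] : Finite (MergeState σ) :=
  Finite.of_surjective
    (fun o : (Fin 9 × Bool × Bool) ⊕ (Fin 5 × σ) ⊕ (Fin 5 × Fin 4 × σ) ⊕
        (Fin 4 × Fin 4 × σ × Bool × Bool) => match o with
      | .inl (n, a, b) => MergeState.boot n a b
      | .inr (.inl (j, q)) => ![.seek q, .next q, .act q, .ret q, .back q] j
      | .inr (.inr (.inl (j, i, q))) =>
        ![.liftR i q, .stepR i q, .place i q, .stepL i q, .drop i q] j
      | .inr (.inr (.inr (n, i, q, a, b))) => .load n i q a b) (by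
    rintro (⟨n, a, b⟩ | q | q | q | ⟨i, q⟩ | ⟨i, q⟩ | ⟨i, q⟩ | ⟨n, i, q, a, b⟩ | ⟨i, q⟩ | ⟨i, q⟩ |
      q | q)
    exacts [⟨.inl (n, a, b), rfl⟩, ⟨.inr (.inl (0, q)), rfl⟩, ⟨.inr (.inl (1, q)), rfl⟩,
      ⟨.inr (.inl (2, q)), rfl⟩, ⟨.inr (.inr (.inl (0, i, q))), rfl⟩,
      ⟨.inr (.inr (.inl (1, i, q))), rfl⟩, ⟨.inr (.inr (.inl (2, i, q))), rfl⟩,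
      ⟨.inr (.inr (.inr (n, i, q, a, b))), rfl⟩, ⟨.inr (.inr (.inl (3, i, q))), rfl⟩,
      ⟨.inr (.inr (.inl (4, i, q))), rfl⟩, ⟨.inr (.inl (3, q)), rfl⟩,
      ⟨.inr (.inl (4, q)), rfl⟩])

open MergeState in
/-- Go to the mark of the tape on which the instruction operates. -/
def seekInstr {σ : Type} (q : σ) : FourInstr σ → TrackInstr (MergeState σ)
  | .test i _ => .test (.mark i) fun b => if b then act q else next q
  | .left i _ => .test (.mark i) fun b => if b then act q else next q
  | .right i _ => .test (.mark i) fun b => if b then act q else next q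
  | .write i _ _ => .test (.mark i) fun b => if b then act q else next q
  | .out b S => .out b (seek S)
  | .accept => .accept
  | .reject => .reject

open MergeState in
/-- Carry out an instruction at the mark of its tape. -/
def actInstr {σ : Type} : FourInstr σ → TrackInstr (MergeState σ)
  | .test i S => .test (.bit i) fun b => ret (S b)
  | .left i S => .set (.mark i) false (stepL i S)
  | .right i S => .set (.mark i) false (stepR i S)
  -- Writing also advances the head, so it continues like a move to the right.
  | .write i b S => .set (.bit i) b (liftR i S)
  | _ => .reject

open MergeState in
/-- The simulation of the four-tape program `P` with initial state `q₀`. -/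
def merge {σ : Type} (P : σ → FourInstr σ) (q₀ : σ) :
    MergeState σ → TrackInstr (MergeState σ)
  | boot 0 _ _ => .input (boot 1)
  | boot 1 a b => .set .loaded true (boot 2 a b)
  | boot 2 a b => .set .first true (boot 3 a b)
  | boot 3 a b => .set (.bit 0) a (boot 4 a b)
  | boot 4 a b => .set (.bit 3) b (boot 5 a b)
  | boot 5 a b => .set (.mark 0) true (boot 6 a b)
  | boot 6 a b => .set (.mark 1) true (boot 7 a b)
  | boot 7 a b => .set (.mark 2) true (boot 8 a b)
  | boot 8 _ _ => .set (.mark 3) true (seek q₀)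
  | seek q => seekInstr q (P q)
  | next q => .right (seek q)
  | act q => actInstr (P q)
  | liftR i S => .set (.mark i) false (stepR i S)
  | stepR i S => .right (place i S)
  | place i S => .test .loaded fun b => if b then drop i S else load 0 i S false false
  | load 0 i S _ _ => .input (load 1 i S)
  | load 1 i S a b => .set .loaded true (load 2 i S a b)
  -- Only tapes `0` and `3` carry arguments; the bits of the other two are zero in a blank cell.
  | load 2 i S a b => .set (.bit 0) a (load 3 i S a b)
  | load 3 i S _ b => .set (.bit 3) b (drop i S)
  | stepL i S => .left (drop i S)
  | drop i S => .set (.mark i) true (ret S)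
  | ret S => .test .first fun b => if b then seek S else back S
  | back S => .left (ret S)

/-- The multi-track tape that represents four tapes with heads, if the first `N` cells have been
initialized. -/
def layout (N : ℕ) (w : Fin 4 → Cantor) (n : Fin 4 → ℕ) : ℕ → Track → Bool
  | p, .loaded => decide (p < N)
  | p, .first => decide (p = 0)
  | p, .bit i => decide (p < N) && w i p
  | p, .mark i => decide (n i = p)

/-- The configurations of the four-tape program and of its simulation correspond. -/
structure MergeRel {σ : Type} (x y : Cantor) (c : FourConfig σ) (d : TrackConfig (MergeState σ)) :
    Prop where
  q : d.q = .seek c.q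
  p : d.p = 0
  T : d.T = layout d.k c.w c.n
  o : d.o = c.o
  m : d.m = c.m
  -- The number of symbols read is also the number of loaded cells. The heads stay among these
  -- cells, and beyond them the four tapes are still in their initial state.
  lt : ∀ i, c.n i < d.k
  rest : ∀ p, d.k ≤ p → ∀ i, c.w i p = fourTapes x y i p

section Merge

variable {σ : Type} {P : σ → FourInstr σ} {q₀ : σ} {x y : Cantor}

local notation "Reaches" => ReflTransGen (TrackStep (merge P q₀) x y)

theorem merge_ret (S : σ) (T : ℕ → Track → Bool) (hT : ∀ p, T p .first = decide (p = 0))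
    (p k : ℕ) (o : Cantor) (m : ℕ) :
    Reaches ⟨.ret S, T, p, k, o, m⟩ ⟨.seek S, T, 0, k, o, m⟩ := by
  induction p with
  | zero =>
    have h := TrackStep.test (P := merge P q₀) (x := x) (y := y)
      ⟨.ret S, T, 0, k, o, m⟩ _ _ rfl
    simp only [hT] at h
    exact .single h
  | succ p ih =>
    have h := TrackStep.test (P := merge P q₀) (x := x) (y := y)
      ⟨.ret S, T, p + 1, k, o, m⟩ _ _ rfl
    simp only [hT] at h
    exact .head h (.head (.left _ _ rfl (Nat.succ_ne_zero p)) ih)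

/-- A scan from the left end meets the mark at `n i`. The hypothesis `hq` treats all instructions
that operate on a tape at once. -/
theorem merge_seek {q : σ} {i : Fin 4}
    (hq : seekInstr q (P q) =
      .test (.mark i) fun b => if b then MergeState.act q else MergeState.next q)
    (N : ℕ) (w : Fin 4 → Cantor) (n : Fin 4 → ℕ) (k : ℕ) (o : Cantor) (m : ℕ) :
    Reaches ⟨.seek q, layout N w n, 0, k, o, m⟩ ⟨.act q, layout N w n, n i, k, o, m⟩ := by
  -- Induction on the distance `j` that remains to the mark.
  have key : ∀ j p, p + j = n i → Reaches ⟨.seek q, layout N w n, p, k, o, m⟩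
      ⟨.act q, layout N w n, n i, k, o, m⟩ := fun j => by
    induction j with
    | zero =>
      intro p hp
      obtain rfl : p = n i := hp
      have h := TrackStep.test (P := merge P q₀) (x := x) (y := y)
        ⟨.seek q, layout N w n, n i, k, o, m⟩ _ _ hq
      simp only [layout, decide_true, if_true] at h
      exact .single h
    | succ j ih =>
      intro p hp
      have h := TrackStep.test (P := merge P q₀) (x := x) (y := y)
        ⟨.seek q, layout N w n, p, k, o, m⟩ _ _ hq
      have hne : n i ≠ p := by omega
      simp only [layout, hne, decide_false, Bool.false_eq_true, if_false] at h
      exact .head h (.head (.right _ _ rfl) (ih (p + 1) (by omega)))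
  exact key (n i) 0 (Nat.zero_add _)

theorem layout_setTrack_mark (N : ℕ) (w : Fin 4 → Cantor) (n : Fin 4 → ℕ) (i : Fin 4) (p : ℕ) :
    setTrack (setTrack (layout N w n) (n i) (.mark i) false) p (.mark i) true =
      layout N w (Function.update n i p) := by
  funext p' t
  cases t with
  | mark j =>
    by_cases hj : j = i
    · subst hj
      by_cases hp : p' = p <;> by_cases hn : p' = n j <;>
        grind [setTrack, layout]
    · simp [setTrack, layout, hj]
  | _ => simp [setTrack, layout]

/-- The bound `p < N` matters because `layout` masks the bits of cells that are not loaded. -/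
theorem layout_setTrack_bit {N : ℕ} (w : Fin 4 → Cantor) (n : Fin 4 → ℕ) (i : Fin 4) {p : ℕ}
    (hp : p < N) (b : Bool) :
    setTrack (layout N w n) p (.bit i) b =
      layout N (Function.update w i (Function.update (w i) p b)) n := by
  funext p' t
  cases t with
  | bit j =>
    by_cases hj : j = i
    · subst hj
      by_cases hp' : p' = p
      · subst hp'
        simp [setTrack, layout, hp]
      · simp [setTrack, layout, hp']
    · simp [setTrack, layout, hj]
  | _ => simp [setTrack, layout]

theorem setTrack_comm (T : ℕ → Track → Bool) (p p' : ℕ) {t t' : Track} (h : t ≠ t')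
    (b b' : Bool) :
    setTrack (setTrack T p t b) p' t' b' = setTrack (setTrack T p' t' b') p t b := by
  funext p₁ t₁
  grind [setTrack]

/-- Initializing the first cell that is not yet in use. -/
theorem layout_load {N : ℕ} (hN : N ≠ 0) {w : Fin 4 → Cantor} (n : Fin 4 → ℕ)
    (hw : ∀ i, w i N = fourTapes x y i N) :
    setTrack (setTrack (setTrack (layout N w n) N .loaded true) N (.bit 0) (x N)) N
      (.bit 3) (y N) = layout (N + 1) w n := by
  funext p t
  cases t with
  | loaded => grind [setTrack, layout]
  | first => simp [setTrack, layout]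
  | mark j => simp [setTrack, layout]
  | bit j =>
    have h := hw j
    by_cases hp : p = N
    · subst hp
      fin_cases j <;> simp_all [setTrack, layout, fourTapes, zeros]
    · have : p < N + 1 ↔ p < N := by omega
      simp [setTrack, layout, hp, this]

theorem merge_drop (i : Fin 4) (S : σ) (N : ℕ) (w : Fin 4 → Cantor) (n : Fin 4 → ℕ) (p k : ℕ)
    (o : Cantor) (m : ℕ) :
    Reaches ⟨.drop i S, setTrack (layout N w n) (n i) (.mark i) false, p, k, o, m⟩
      ⟨.seek S, layout N w (Function.update n i p), 0, k, o, m⟩ := by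
  refine .head (.set _ _ _ _ rfl) ?_
  simp only [layout_setTrack_mark]
  exact merge_ret _ _ (fun _ => rfl) _ _ _ _

/-- The right neighbour of a loaded cell is either loaded or the first blank cell. In the latter
case it is loaded now, so `N'` is `N` or `N + 1`. -/
theorem merge_right (i : Fin 4) (S : σ) {N : ℕ} {w : Fin 4 → Cantor} {n : Fin 4 → ℕ}
    (hlt : ∀ i, n i < N) (hrest : ∀ p, N ≤ p → ∀ i, w i p = fourTapes x y i p)
    (o : Cantor) (m : ℕ) :
    ∃ N', N ≤ N' ∧ n i + 1 < N' ∧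
      Reaches ⟨.stepR i S, setTrack (layout N w n) (n i) (.mark i) false, n i, N, o, m⟩
        ⟨.seek S, layout N' w (Function.update n i (n i + 1)), 0, N', o, m⟩ := by
  have h := TrackStep.test (P := merge P q₀) (x := x) (y := y)
    ⟨.place i S, setTrack (layout N w n) (n i) (.mark i) false, n i + 1, N, o, m⟩ _ _ rfl
  by_cases hN : n i + 1 < N
  · refine ⟨N, le_rfl, hN, .head (.right _ _ rfl) ?_⟩
    simp only [setTrack, layout, hN, reduceCtorEq, and_false, if_false, decide_true, if_true] at h
    exact .head h (merge_drop _ _ _ _ _ _ _ _ _)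
  · have hi := hlt i
    obtain rfl : n i + 1 = N := by omega
    refine ⟨n i + 1 + 1, Nat.le_succ _, Nat.lt_succ_self _, .head (.right _ _ rfl) ?_⟩
    simp only [setTrack, layout, hN, reduceCtorEq, and_false, if_false, decide_false,
      Bool.false_eq_true] at h
    refine .head h (.head (.input _ _ rfl) (.head (.set _ _ _ _ rfl) (.head (.set _ _ _ _ rfl)
      (.head (.set _ _ _ _ rfl) ?_))))
    have hl := layout_load (Nat.succ_ne_zero _) n (hrest _ le_rfl)
    have hd := merge_drop (P := P) (q₀ := q₀) (x := x) (y := y) i S (n i + 1 + 1) w n (n i + 1)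
      (n i + 1 + 1) o m
    -- The program lifts the mark before it loads the cell, the layout identities assume the
    -- opposite order; the tracks differ, so the changes commute.
    rw [← hl, setTrack_comm (t := .bit 3) (h := by simp), setTrack_comm (t := .bit 0) (h := by simp),
      setTrack_comm (t := .loaded) (h := by simp)] at hd
    exact hd

/-- Except for output, each step becomes a round trip: from the left end to the mark, the action
there, and back. -/
theorem merge_step {c c' : FourConfig σ} {d : TrackConfig (MergeState σ)}
    (h : MergeRel x y c d) (hs : FourStep P c c') : ∃ d', Reaches d d' ∧ MergeRel x y c' d' := by
  obtain ⟨q, w, n, _, _⟩ := c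
  obtain ⟨_, _, _, k, o, m⟩ := d
  obtain ⟨hq, hp, hT, ho, hm, hlt, hrest⟩ := h
  dsimp only at hq hp hT ho hm hlt hrest
  subst hq hp hT ho hm
  have hact : ∀ I, P q = I → merge P q₀ (.act q) = actInstr I := by
    rintro _ rfl
    rfl
  cases hs with
  | test i S h =>
    refine ⟨_, (merge_seek (i := i) (by rw [h]; rfl) _ _ _ _ _ _).trans
      (.head (.test _ (.bit i) (fun b => MergeState.ret (S b)) ?_) (merge_ret _ _ (fun _ => rfl) _ _ _ _)),
      ?_, rfl, rfl, rfl, rfl, hlt, hrest⟩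
    · exact hact _ h
    · simp [layout, hlt i]
  | left i S h hn =>
    refine ⟨_, (merge_seek (i := i) (by rw [h]; rfl) _ _ _ _ _ _).trans
      (.head (.set _ (.mark i) false (MergeState.stepL i S) (hact _ h))
        (.head (.left _ _ rfl hn) (merge_drop _ _ _ _ _ _ _ _ _))),
      rfl, rfl, rfl, rfl, rfl, fun j => ?_, hrest⟩
    have := hlt j
    by_cases hj : j = i
    · subst hj
      simp only [Function.update_self]
      omega
    · simpa [hj] using this
  | right i S h =>
    obtain ⟨N', hN, hN', hr⟩ := merge_right (P := P) (q₀ := q₀) i S hlt hrest o m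
    refine ⟨_, (merge_seek (i := i) (by rw [h]; rfl) _ _ _ _ _ _).trans
      (.head (.set _ (.mark i) false (MergeState.stepR i S) (hact _ h)) hr),
      rfl, rfl, rfl, rfl, rfl, fun j => ?_, fun p hp => hrest p (hN.trans hp)⟩
    by_cases hj : j = i
    · subst hj
      simpa using hN'
    · simpa [hj] using (hlt j).trans_le hN
  | write i b S h =>
    -- The written cell is a loaded one, so the tapes after writing still satisfy the hypothesis of
    -- `merge_right`.
    have hrest' : ∀ p, k ≤ p → ∀ j,
        Function.update w i (Function.update (w i) (n i) b) j p = fourTapes x y j p := by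
      intro p hp j
      rw [← hrest p hp j]
      have := hlt i
      by_cases hj : j = i
      · subst hj
        simp only [Function.update_self]
        exact Function.update_of_ne (by omega) _ _
      · simp [hj]
    obtain ⟨N', hN, hN', hr⟩ := merge_right (P := P) (q₀ := q₀) i S hlt hrest' o m
    rw [← layout_setTrack_bit w n i (hlt i) b] at hr
    refine ⟨_, (merge_seek (i := i) (by rw [h]; rfl) _ _ _ _ _ _).trans
      (.head (.set _ (.bit i) b (MergeState.liftR i S) (hact _ h))
        (.head (.set _ _ _ _ rfl) hr)),
      rfl, rfl, rfl, rfl, rfl, fun j => ?_, fun p hp => hrest' p (hN.trans hp)⟩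
    by_cases hj : j = i
    · subst hj
      simpa using hN'
    · simpa [hj] using (hlt j).trans_le hN
  | out b S h =>
    have hseek : merge P q₀ (.seek q) = seekInstr q (.out b S) := congrArg (seekInstr q) h
    exact ⟨_, .single (.out _ b (MergeState.seek S) hseek),
      rfl, rfl, rfl, rfl, rfl, hlt, hrest⟩

/-- The boot states load cell `0` and put all marks on it, so the correspondence starts with one
loaded cell. -/
theorem merge_boot : ∃ d, Reaches (.init (.boot 0 false false)) d ∧
    MergeRel x y (.init q₀ x y) d := by
  refine ⟨_, .head (.input _ _ rfl) (.head (.set _ _ _ _ rfl) (.head (.set _ _ _ _ rfl)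
    (.head (.set _ _ _ _ rfl) (.head (.set _ _ _ _ rfl) (.head (.set _ _ _ _ rfl)
    (.head (.set _ _ _ _ rfl) (.head (.set _ _ _ _ rfl) (.single (.set _ _ _ _ rfl))))))))),
    rfl, rfl, ?_, rfl, rfl, fun i => Nat.zero_lt_one, fun p _ i => rfl⟩
  funext p t
  cases t with
  | loaded => simp [setTrack, layout, TrackConfig.init]
  | first => simp [setTrack, layout, TrackConfig.init]
  | bit i =>
    by_cases hp : p = 0 <;> fin_cases i <;>
      simp [setTrack, layout, TrackConfig.init, FourConfig.init, fourTapes, hp, zeros]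
  | mark i =>
    by_cases hp : p = 0 <;> fin_cases i <;>
      simp [setTrack, layout, TrackConfig.init, FourConfig.init, hp, eq_comm]

end Merge

/-- Every four-tape program is simulated by a program with one multi-track tape. -/
theorem merge_yields {σ : Type} {P : σ → FourInstr σ} {q₀ : σ} {x y v : Cantor}
    (h : (fourSystem P).Yields (.init q₀ x y) v) :
    (trackSystem (merge P q₀) x y).Yields (.init (.boot 0 false false)) v := by
  obtain ⟨d, hd, hR⟩ := merge_boot (P := P) (q₀ := q₀) (x := x) (y := y)
  refine .of_reflTransGen (A := trackSystem (merge P q₀) x y) hd hR.m.le ?_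
  refine .of_sim (A := fourSystem P) (B := trackSystem (merge P q₀) x y) (MergeRel x y)
    (fun _ _ _ => merge_step) (fun c d hR ha => ?_) (fun _ _ hR => hR.o) (fun _ _ hR => hR.m) hR h
  change merge P q₀ d.q = _
  rw [hR.q]
  exact congrArg (seekInstr c.q) ha

/-! ### Multi-track programs on ordinary machines

Every cell of the multi-track tape is represented by ten consecutive cells of the first working
tape. The arguments `x` and `y` are either interleaved on the input tape, or else `x` is on the
input tape and `y` is on the second working tape. -/

/-- The position of a track in the block of a cell. -/
def Track.index : Track → Fin 10
  | .loaded => 0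
  | .first => 1
  | .bit i => i.castLE (by decide) + 2
  | .mark i => i.castLE (by decide) + 6

theorem Track.index_injective : Function.Injective Track.index := by
  rintro (_ | _ | i | i) (_ | _ | j | j) h <;> (try fin_cases i) <;> (try fin_cases j) <;>
    first | rfl | exact absurd h (by decide)

/-- The states of the machine that works on blocks. -/
inductive BlockState (σ : Type) : Type
  | goR (n : Fin 11) (q : σ)
  | goL (n : Fin 11) (q : σ)
  | fetch (n : Fin 3) (q : σ) (a b : Bool)

instance (σ : Type) [Finite σ] : Finite (BlockState σ) :=
  Finite.of_surjective
    (fun o : (Fin 11 × σ) ⊕ (Fin 11 × σ) ⊕ (Fin 3 × σ × Bool × Bool) => match o with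
      | .inl (n, q) => BlockState.goR n q
      | .inr (.inl (n, q)) => .goL n q
      | .inr (.inr (n, q, a, b)) => .fetch n q a b) (by
    rintro (⟨n, q⟩ | ⟨n, q⟩ | ⟨n, q, a, b⟩)
    exacts [⟨.inl (n, q), rfl⟩, ⟨.inr (.inl (n, q)), rfl⟩, ⟨.inr (.inr (n, q, a, b)), rfl⟩])

/-- How far the head moves to the right before an instruction is carried out. -/
def TrackInstr.offset {σ : Type} : TrackInstr σ → Fin 11
  | .test t _ => t.index.castSucc
  | .set t _ _ => t.index.castSucc
  | .right _ => 10
  | _ => 0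

open BlockState in
/-- Carry out an instruction. -/
def blockAct {σ : Type} (q : σ) : TrackInstr σ → Instr (BlockState σ)
  | .test t S => .test 1 fun b => goL t.index.castSucc (S b)
  -- Writing moves the head one cell on, so the way back is longer by one.
  | .set t b S => .write 0 b (goL t.index.succ S)
  | .left S => .test 0 fun _ => goL 10 S
  | .right S => .test 0 fun _ => goL 0 S
  | .input _ => .test 0 fun a => fetch 0 q a false
  | .out b S => .write 2 b (goL 0 S)
  | .accept => .accept
  | .reject => .reject

/-- The state after an instruction that reads the symbols `a` and `b`. -/
def TrackInstr.afterInput {σ : Type} (q : σ) (a b : Bool) : TrackInstr σ → σ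
  | .input S => S a b
  -- A dummy value: the `fetch` states are entered only from an `input` instruction.
  | _ => q

/-- The tape that contains the second argument. -/
def secondTape (two : Bool) : Fin 3 := if two then 2 else 0

open BlockState in
/-- The instruction table of the machine that works on blocks. -/
def blockTable {σ : Type} (two : Bool) (P : σ → TrackInstr σ) :
    BlockState σ → Instr (BlockState σ)
  | goR ⟨0, _⟩ q => blockAct q (P q)
  | goR ⟨n + 1, h⟩ q => .right 1 (goR ⟨n, Nat.lt_of_succ_lt h⟩ q)
  | goL ⟨0, _⟩ q => .test 0 fun _ => goR (P q).offset q
  | goL ⟨n + 1, h⟩ q => .left 1 (goL ⟨n, Nat.lt_of_succ_lt h⟩ q)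
  -- The same table serves both arrangements: if the second argument is on tape `0` too, its symbol
  -- is the next one there.
  | fetch 0 q a _ => .right 0 (fetch 1 q a false)
  | fetch 1 q a _ => .test (secondTape two) fun b => fetch 2 q a b
  | fetch 2 q a b => .right (secondTape two) (goL 0 ((P q).afterInput q a b))

theorem blockTable_not_isQuery {σ : Type} (two : Bool) (P : σ → TrackInstr σ)
    (q : BlockState σ) : ¬ (blockTable two P q).IsQuery := by
  rintro ⟨S₀, S₁, h⟩
  unfold blockTable at h
  split at h <;> try simp at h
  unfold blockAct at h
  split at h <;> simp at h

/-- The machine that works on blocks. -/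
def blockMachine {σ : Type} [Finite σ] (two : Bool) (P : σ → TrackInstr σ) (q₀ : σ) :
    OracleMachine :=
  ofTable (blockTable two P) (.goL 0 q₀)

/-- The symbols of the arguments from position `k` on are ahead of the heads. -/
def ArgsAt (two : Bool) (x y : Cantor) (k : ℕ) (w : Fin 4 → Cantor) (n : Fin 4 → ℕ) : Prop :=
  match two with
  | false => w 0 = pair x y ∧ n 0 = 2 * k
  | true => w 0 = x ∧ w 2 = y ∧ n 0 = k ∧ n 2 = k

theorem ArgsAt.congr {two : Bool} {x y : Cantor} {k : ℕ} {w w' : Fin 4 → Cantor}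
    {n n' : Fin 4 → ℕ} (h : ArgsAt two x y k w n) (hw₀ : w' 0 = w 0) (hw₂ : w' 2 = w 2)
    (hn₀ : n' 0 = n 0) (hn₂ : n' 2 = n 2) : ArgsAt two x y k w' n' := by
  cases two <;> simp_all [ArgsAt]

/-- The configurations of the multi-track program and of the machine correspond. -/
structure BlockRel {σ : Type} [Finite σ] (two : Bool) (P : σ → TrackInstr σ) (x y : Cantor)
    (c : TrackConfig σ) (d : Config (Node (BlockState σ))) : Prop where
  q : d.q = .node (.goR (P c.q).offset c.q)
  tape : ∀ p t, d.w 1 (p * 10 + Track.index t) = c.T p t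
  head : d.n 1 = c.p * 10
  args : ArgsAt two x y c.k d.w d.n
  o : d.w 3 = c.o
  m : d.n 3 = c.m

section Block

variable {σ : Type} [Finite σ] {two : Bool} {P : σ → TrackInstr σ} {q₀ : σ} {x y : Cantor}

local notation "Reaches" => ReflTransGen (OracleMachine.Step (blockMachine two P q₀))

theorem block_goR (q : σ) (w : Fin 4 → Cantor) (j : ℕ) (hj : j < 11) (n : Fin 4 → ℕ) :
    Reaches ⟨.node (.goR ⟨j, hj⟩ q), w, n⟩
      ⟨.node (.goR 0 q), w, Function.update n 1 (n 1 + j)⟩ := by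
  induction j generalizing n with
  | zero => simpa using ReflTransGen.refl
  | succ j ih =>
    have h := ih (by omega) (Function.update n 1 (n 1 + 1))
    simp only [Function.update_self, Function.update_idem, add_assoc, add_comm 1] at h
    exact .head (.right _ 1 _ rfl) h

theorem block_goL (q : σ) (w : Fin 4 → Cantor) (j : ℕ) (hj : j < 11) (n : Fin 4 → ℕ)
    (hn : j ≤ n 1) :
    Reaches ⟨.node (.goL ⟨j, hj⟩ q), w, n⟩
      ⟨.node (.goR (P q).offset q), w, Function.update n 1 (n 1 - j)⟩ := by
  induction j generalizing n with
  | zero =>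
    simp only [Nat.sub_zero, Function.update_eq_self]
    exact .single (.test (M := blockMachine two P q₀) ⟨.node (.goL ⟨0, hj⟩ q), w, n⟩ 0 _ rfl)
  | succ j ih =>
    have h := ih (by omega) (Function.update n 1 (n 1 - 1))
      (by rw [Function.update_self]; omega)
    simp only [Function.update_self, Function.update_idem, Nat.sub_sub, add_comm 1] at h
    exact .head (.left _ 1 _ rfl (Nat.ne_of_gt (Nat.lt_of_lt_of_le (Nat.succ_pos j) hn))) h

/-- Going to the position of an instruction. -/
theorem block_offset (q : σ) {I : TrackInstr σ} (hI : P q = I) (w : Fin 4 → Cantor)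
    (n : Fin 4 → ℕ) :
    Reaches ⟨.node (.goR (P q).offset q), w, n⟩
      ⟨.node (.goR 0 q), w, Function.update n 1 (n 1 + I.offset)⟩ := by
  subst hI
  exact block_goR _ _ _ _ _

/-- The vertex where an instruction is carried out. -/
theorem block_act {q : σ} {I : TrackInstr σ} (hI : P q = I) :
    (blockMachine two P q₀).instr (.node (.goR 0 q)) = (blockAct q I).embed .node := by
  subst hI
  rfl

/-- Between instructions the head is at the start of a block. It moves by the offset, acts and
returns; `right` omits the return, and `left` returns by ten cells without having advanced. -/
theorem block_step {c c' : TrackConfig σ} {d : Config (Node (BlockState σ))}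
    (h : BlockRel two P x y c d) (hs : TrackStep P x y c c') :
    ∃ d', Reaches d d' ∧ BlockRel two P x y c' d' := by
  obtain ⟨q, T, p, k, o, m⟩ := c
  obtain ⟨dq, w, n⟩ := d
  obtain ⟨hq, htape, hhead, hargs, ho, hm⟩ := h
  dsimp only at hq htape hhead hargs ho hm
  subst hq
  cases hs with
  | test t S h =>
    have h₁ := OracleMachine.Step.test (M := blockMachine two P q₀)
      ⟨.node (.goR 0 q), w, Function.update n 1 (n 1 + t.index)⟩ 1 _ (block_act h)
    refine ⟨_, (block_offset q h w n).trans (.head h₁ (block_goL _ _ t.index _ _ ?_)),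
      ?_, htape, ?_, ?_, ho, ?_⟩
    · simp
    · simp [← htape, hhead]
    · simp [hhead]
    · exact hargs.congr rfl rfl (by simp) (by simp)
    · simpa using hm
  | set t b S h =>
    have h₁ := OracleMachine.Step.write (M := blockMachine two P q₀)
      ⟨.node (.goR 0 q), w, Function.update n 1 (n 1 + t.index)⟩ 0 b _ (block_act h)
    refine ⟨_, (block_offset q h w n).trans (.head h₁ (block_goL _ _ (t.index + 1) (by omega) _ ?_)),
      rfl, fun p' t' => ?_, ?_, ?_, ?_, ?_⟩
    · simp
    -- Track indices are below ten and distinct, so an address determines cell and track.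
    · by_cases hi : p' * 10 + t'.index = p * 10 + t.index
      · have hp : p' = p := by omega
        have ht : t' = t := Track.index_injective (Fin.ext (by omega))
        subst hp ht
        simp [setTrack, hhead]
      · have hpt : ¬ (p' = p ∧ t' = t) := fun ⟨hp, ht⟩ => hi (by rw [hp, ht])
        simp [setTrack, hhead, hi, hpt, htape]
    · simp [hhead]
    · exact hargs.congr (by simp) (by simp) (by simp) (by simp)
    · simpa using ho
    · simpa using hm
  | right S h =>
    have h₁ := OracleMachine.Step.test (M := blockMachine two P q₀)
      ⟨.node (.goR 0 q), w, Function.update n 1 (n 1 + 10)⟩ 0 _ (block_act h)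
    refine ⟨_, (block_offset q h w n).trans (.head h₁ (block_goL _ _ 0 (by omega) _ ?_)),
      rfl, htape, ?_, ?_, ho, ?_⟩
    · simp
    · simp [hhead, add_mul]
    · exact hargs.congr rfl rfl (by simp) (by simp)
    · simpa using hm
  | left S h hp =>
    have h₁ := OracleMachine.Step.test (M := blockMachine two P q₀)
      ⟨.node (.goR 0 q), w, Function.update n 1 (n 1 + 0)⟩ 0 _ (block_act h)
    refine ⟨_, (block_offset q h w n).trans (.head h₁ (block_goL _ _ 10 (by omega) _ ?_)),
      rfl, htape, ?_, ?_, ho, ?_⟩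
    · dsimp only at hp
      simp [hhead]
      omega
    · simp [hhead, Nat.sub_mul]
    · exact hargs.congr rfl rfl (by simp) (by simp)
    · simpa using hm
  | input S h =>
    have h₁ := OracleMachine.Step.test (M := blockMachine two P q₀)
      ⟨.node (.goR 0 q), w, Function.update n 1 (n 1 + 0)⟩ 0 _ (block_act h)
    have h₂ := OracleMachine.Step.right (M := blockMachine two P q₀)
      ⟨.node (.fetch 0 q (w 0 (n 0)) false), w, n⟩ 0 _ rfl
    have h₃ := OracleMachine.Step.test (M := blockMachine two P q₀)
      ⟨.node (.fetch 1 q (w 0 (n 0)) false), w, Function.update n 0 (n 0 + 1)⟩ (secondTape two) _ rfl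
    have h₄ := fun b => OracleMachine.Step.right (M := blockMachine two P q₀)
      ⟨.node (.fetch 2 q (w 0 (n 0)) b), w, Function.update n 0 (n 0 + 1)⟩ (secondTape two) _ rfl
    simp only [add_zero, Function.update_eq_self] at h₁
    have hr := block_offset (two := two) (q₀ := q₀) q h w n
    have hoff : Function.update n 1 (n 1 + (TrackInstr.input S).offset) = n := by
      simp [TrackInstr.offset]
    rw [hoff] at hr
    have hk : (2 * k + 1) / 2 = k := by omega
    dsimp only at h
    refine ⟨_, hr.trans (.head h₁ (.head h₂ (.head h₃ (.head (h₄ _) (block_goL _ _ 0 (by omega) _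
      (Nat.zero_le _)))))), ?_⟩
    cases two with
    | false =>
      obtain ⟨hw, hn⟩ := hargs
      refine ⟨?_, htape, ?_, ?_, ho, ?_⟩
      · simp [secondTape, hw, hn, hk, pair, h, TrackInstr.afterInput]
      · simp [secondTape, hhead]
      · simp [ArgsAt, secondTape, hw, hn]
        ring
      · simpa [secondTape] using hm
    | true =>
      obtain ⟨hw₀, hw₂, hn₀, hn₂⟩ := hargs
      refine ⟨?_, htape, ?_, ?_, ho, ?_⟩
      · simp [secondTape, hw₀, hw₂, hn₀, hn₂, h, TrackInstr.afterInput]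
      · simp [secondTape, hhead]
      · simp [ArgsAt, secondTape, hw₀, hw₂, hn₀, hn₂]
      · simpa [secondTape] using hm
  | out b S h =>
    have h₁ := OracleMachine.Step.write (M := blockMachine two P q₀)
      ⟨.node (.goR 0 q), w, Function.update n 1 (n 1 + 0)⟩ 2 b _ (block_act h)
    refine ⟨_, (block_offset q h w n).trans (.head h₁ (block_goL _ _ 0 (by omega) _ ?_)),
      rfl, ?_, ?_, ?_, ?_, ?_⟩
    · simp
    · simpa using htape
    · simp [hhead]
    · exact hargs.congr (by simp) (by simp) (by simp) (by simp)
    · simp [ho, hm]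
    · simp [hm]

end Block

/-- Multi-track programs are simulated by machines that work on blocks. -/
theorem block_yields {σ : Type} [Finite σ] {two : Bool} {P : σ → TrackInstr σ} {q₀ : σ}
    {x y v : Cantor} (h : (trackSystem P x y).Yields (.init q₀) v)
    (d : Config (blockMachine two P q₀).Q) (hq : d.q = .source)
    (hargs : ArgsAt two x y 0 d.w d.n) (hw₁ : d.w 1 = zeros) (hn₁ : d.n 1 = 0)
    (hw₃ : d.w 3 = zeros) (hn₃ : d.n 3 = 0) :
    (blockMachine two P q₀).Yields (ReflTransGen (blockMachine two P q₀).Step) d v := by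
  obtain ⟨q, w, n⟩ := d
  dsimp only at hq hargs hw₁ hn₁ hw₃ hn₃
  subst hq
  have hreach : ReflTransGen (blockMachine two P q₀).Step ⟨.source, w, n⟩
      ⟨.node (.goR (P q₀).offset q₀), w, n⟩ :=
    .head (ofTable_step_source _ _ _ _) (.single
      (.test (M := blockMachine two P q₀) ⟨.node (.goL 0 q₀), w, n⟩ 0 _ rfl))
  refine OutputSystem.Yields.of_reflTransGen (A := (blockMachine two P q₀).system _) hreach le_rfl ?_
  refine OutputSystem.Yields.of_sim (A := trackSystem P x y) (B := (blockMachine two P q₀).system _)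
    (BlockRel two P x y) (fun _ _ _ => block_step) (fun c d hR ha => ?_) (fun _ _ hR => hR.o)
    (fun _ _ hR => hR.m)
    ⟨rfl, fun p t => by simp [hw₁, zeros, TrackConfig.init], by simp [hn₁, TrackConfig.init],
      hargs, hw₃, hn₃⟩ h
  replace ha : P c.q = .accept := ha
  change (blockMachine two P q₀).instr d.q = _
  rw [hR.q, ha]
  exact block_act ha

/-! ### Four-tape programs on ordinary machines -/

/-- The machine that simulates a four-tape program. -/
def fourMachine {σ : Type} [Finite σ] (two : Bool) (P : σ → FourInstr σ) (q₀ : σ) :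
    OracleMachine :=
  blockMachine two (merge P q₀) (.boot 0 false false)

theorem fourMachine_isType2 {σ : Type} [Finite σ] (two : Bool) (P : σ → FourInstr σ) (q₀ : σ) :
    (fourMachine two P q₀).IsType2 :=
  ofTable_isType2 _ (blockTable_not_isQuery _ _)

/-- Four-tape programs are simulated on interleaved arguments. -/
theorem fourMachine_yields_pair {σ : Type} [Finite σ] {P : σ → FourInstr σ} {q₀ : σ}
    {x y v : Cantor} (h : (fourSystem P).Yields (.init q₀ x y) v) :
    v ∈ (fourMachine false P q₀).pfun (pair x y) :=
  OracleMachine.mem_pfun.2 (block_yields (merge_yields h) _ rfl ⟨rfl, rfl⟩ rfl rfl rfl rfl)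

/-- Four-tape programs are simulated if the second argument is on the second working tape. -/
theorem fourMachine_yields_answer {σ : Type} [Finite σ] {P : σ → FourInstr σ} {q₀ : σ}
    {x y v : Cantor} (h : (fourSystem P).Yields (.init q₀ x y) v) :
    (fourMachine true P q₀).Yields (ReflTransGen (fourMachine true P q₀).Step)
      ⟨(fourMachine true P q₀).s, ![x, zeros, y, zeros], fun _ => 0⟩ v :=
  block_yields (merge_yields h) _ rfl ⟨rfl, rfl, rfl, rfl⟩ rfl rfl rfl rfl

/-! ### From machines with a single oracle call to reductions -/

section SingleCall

variable (M : OracleMachine)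

/-- The instructions of the machine that computes the query. Before the query, it does not
write on the output tape. -/
def queryInstr : Bool → Instr M.Q → Instr (Bool × M.Q)
  | false, .query _ S₁ => .test 0 fun _ => (true, S₁)
  | false, .write 2 _ S => .test 0 fun _ => (false, S)
  -- At query depth one, a query computation has no step at a query vertex.
  | true, .query _ _ => .reject
  | p, I => I.embed (Prod.mk p)

/-- The machine that computes the query. -/
def queryMachine : OracleMachine :=
  haveI := M.fin
  ofTable (fun v : Bool × M.Q => queryInstr M v.1 (M.instr v.2)) (false, M.s)

theorem queryMachine_isType2 : (queryMachine M).IsType2 := by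
  refine haveI := M.fin; ofTable_isType2 _ ?_
  rintro ⟨p, q⟩ ⟨S₀, S₁, h⟩
  dsimp only at h
  cases p <;> cases hI : M.instr q with
  | write i b S => rw [hI] at h; fin_cases i <;> exact nomatch h
  | _ => rw [hI] at h; exact nomatch h

/-- The configuration with erased output tape, as a configuration of the machine that computes
the query. -/
def eraseConfig (c : Config M.Q) : Config (queryMachine M).Q where
  q := .node (false, c.q)
  w := Function.update c.w 3 zeros
  n := Function.update c.n 3 0

variable {M}

theorem queryMachine_instr {p : Bool} {q : M.Q} {I : Instr M.Q} (h : M.instr q = I) :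
    (queryMachine M).instr (.node (p, q)) = (queryInstr M p I).embed .node := by
  subst h
  rfl

/-- Steps before the query are simulated without output. -/
theorem queryMachine_step {c c' : Config M.Q} (hs : M.Step c c') :
    (queryMachine M).Step (eraseConfig M c) (eraseConfig M c') := by
  cases hs with
  | start S h => exact .test (M := queryMachine M) (eraseConfig M c) 0 _ (queryMachine_instr h)
  | test i S h =>
    convert OracleMachine.Step.test (M := queryMachine M) (eraseConfig M c) i _
      (queryMachine_instr h) using 1
    fin_cases i <;> rfl
  | right i S h =>
    convert OracleMachine.Step.right (M := queryMachine M) (eraseConfig M c) i _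
      (queryMachine_instr h) using 1
    simp only [eraseConfig]
    congr 1
    funext j
    fin_cases i <;> fin_cases j <;> rfl
  | left i S h hn =>
    have hn' : (eraseConfig M c).n i.castSucc ≠ 0 := by
      fin_cases i <;> exact hn
    convert OracleMachine.Step.left (M := queryMachine M) (eraseConfig M c) i _
      (queryMachine_instr h) hn' using 1
    simp only [eraseConfig]
    congr 1
    funext j
    fin_cases i <;> fin_cases j <;> rfl
  | write i b S h =>
    -- This is the write on the output tape, which `eraseConfig` forgets; a test with equal
    -- successors replaces it.
    by_cases hi : i = 2
    · subst hi
      convert OracleMachine.Step.test (M := queryMachine M) (eraseConfig M c) 0 _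
        (queryMachine_instr h) using 1
      simp only [eraseConfig]
      congr 1 <;> funext j <;> fin_cases j <;> rfl
    · have hI : queryInstr M false (.write i b S) = .write i b (false, S) := by
        fin_cases i
        · rfl
        · rfl
        · exact absurd rfl hi
      convert OracleMachine.Step.write (M := queryMachine M) (eraseConfig M c) i b _
        ((queryMachine_instr h).trans (congrArg (Instr.embed Node.node) hI)) using 1
      simp only [eraseConfig]
      congr 1 <;> funext j <;> fin_cases i <;> first | exact absurd rfl hi | fin_cases j <;> rfl

/-- The query of a run is the value of the machine that computes the query. -/
theorem mem_queryMachine_pfun {O : MultiFun} {x z : Cantor} {c : Config M.Q} {S₀ S₁ : M.Q}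
    (hr : M.Run O 1 (M.init x) 0 c) (hq : M.instr c.q = .query S₀ S₁)
    (hz : M.Yields (ReflTransGen M.Step) (M.queryConfig c S₁) z) :
    z ∈ (queryMachine M).pfun x := by
  have h₀ : (queryMachine M).Step ((queryMachine M).init x) (eraseConfig M (M.init x)) := by
    have := M.fin
    have he : eraseConfig M (M.init x) =
        ⟨.node (false, M.s), ((queryMachine M).init x).w, ((queryMachine M).init x).n⟩ := by
      simp only [eraseConfig, OracleMachine.init]
      congr 1 <;> funext j <;> fin_cases j <;> rfl
    rw [he]
    exact ofTable_step_source _ _ _ _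
  have h₁ : ReflTransGen (queryMachine M).Step (eraseConfig M (M.init x)) (eraseConfig M c) :=
    ReflTransGen.lift (eraseConfig M) (fun _ _ => queryMachine_step) _ _ hr.reflTransGen
  have h₂ : (queryMachine M).Step (eraseConfig M c)
      ((M.queryConfig c S₁).map fun q => .node (true, q)) :=
    .test (M := queryMachine M) (eraseConfig M c) 0 _ (queryMachine_instr hq)
  -- The output head is at `0` both initially and when the query computation starts, so the steps in
  -- between can be prepended.
  refine OracleMachine.mem_pfun.2 (OutputSystem.Yields.of_reflTransGen
    (A := (queryMachine M).system (queryMachine M).Step) (.head h₀ (h₁.tail h₂)) le_rfl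
    (OracleMachine.Yields.map (M' := queryMachine M) (fun q hq => ?_) hz))
  have hI : queryInstr M true (M.instr q) = (M.instr q).embed (Prod.mk true) := by
    unfold queryInstr
    split <;> simp_all [Instr.IsQuery]
  exact (queryMachine_instr rfl).trans
    ((congrArg (Instr.embed Node.node) hI).trans (Instr.embed_embed _ _ _))

/-! ### Replaying a machine with the answer supplied -/

/-- The tape of the four-tape program that represents a tape of the machine, before and after the
oracle call. -/
def resumeTape : Bool → Fin 3 → Fin 4
  | true, 2 => 3
  | _, i => i.castSucc

/-- The instructions of the four-tape program that computes the output from the input and the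
answer of the oracle. -/
def resumeInstr {Q : Type} (p : Bool) : Instr Q → FourInstr (Bool × Q)
  | .start S => .test 0 fun _ => (p, S)
  | .test i S => .test (resumeTape p i) fun b => (p, S b)
  | .left i S => .left (resumeTape p i) (p, S)
  | .right i S => .right (resumeTape p i) (p, S)
  | .write 0 b S => .write (resumeTape p 1) b (p, S)
  | .write 1 b S => .write (resumeTape p 2) b (p, S)
  | .write 2 b S => .out b (p, S)
  -- The first call only switches the phase; a second one is excluded where the program is applied.
  | .query S₀ _ => if p then .reject else .test 0 fun _ => (true, S₀)
  | .accept => .accept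
  | .reject => .reject

variable (M) in
/-- The four-tape program that computes the output from the input and the answer of the
oracle. -/
def resumeProgram (v : Bool × M.Q) : FourInstr (Bool × M.Q) := resumeInstr v.1 (M.instr v.2)

/-- The configurations of the machine and of the four-tape program correspond. -/
structure ResumeRel (y : Cantor) (p : Bool) (c : Config M.Q) (d : FourConfig (Bool × M.Q)) :
    Prop where
  q : d.q = (p, c.q)
  w : ∀ i, d.w (resumeTape p i) = c.w i.castSucc
  n : ∀ i, d.n (resumeTape p i) = c.n i.castSucc
  o : d.o = c.w 3
  m : d.m = c.n 3
  answer : p = false → d.w 3 = y ∧ d.n 3 = 0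

theorem resumeTape_injective (p : Bool) : Function.Injective (resumeTape p) := by
  revert p
  decide

theorem resumeTape_false_ne (i : Fin 3) : resumeTape false i ≠ 3 := by
  revert i
  decide

/-- The assignment of tapes is fixed within a phase and injective, so an update of one tape spares
the others. Before the call no instruction reaches tape `3`, which preserves the answer. -/
theorem resume_step {y : Cantor} {p : Bool} {c c' : Config M.Q} {d : FourConfig (Bool × M.Q)}
    (h : ResumeRel y p c d) (hs : M.Step c c') :
    ∃ d', ReflTransGen (FourStep (resumeProgram M)) d d' ∧ ResumeRel y p c' d' := by
  obtain ⟨_, w, n, o, m⟩ := d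
  obtain ⟨hq, hw, hn, ho, hm, ha⟩ := h
  dsimp only at hq hw hn ho hm ha
  subst hq
  have hp : ∀ I, M.instr c.q = I → resumeProgram M (p, c.q) = resumeInstr p I := by
    rintro _ rfl
    rfl
  cases hs with
  | start S h => exact ⟨_, .single (.test _ 0 _ (hp _ h)), rfl, hw, hn, ho, hm, ha⟩
  | test i S h =>
    refine ⟨_, .single (.test _ (resumeTape p i) _ (hp _ h)), ?_, hw, hn, ho, hm, ha⟩
    simp [hw, hn]
  | right i S h =>
    refine ⟨_, .single (.right _ (resumeTape p i) _ (hp _ h)), rfl, hw, fun j => ?_, ho, ?_, ?_⟩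
    · by_cases hj : j = i
      · subst hj; simp [hn]
      · simp [hj, hn, (resumeTape_injective p).eq_iff]
    · fin_cases i <;> exact hm
    · rintro rfl
      simpa [(resumeTape_false_ne i).symm] using ha
  | left i S h h0 =>
    refine ⟨_, .single (.left _ (resumeTape p i) _ (hp _ h) ((hn i).trans_ne h0)), rfl, hw,
      fun j => ?_, ho, ?_, ?_⟩
    · by_cases hj : j = i
      · subst hj; simp [hn]
      · simp [hj, hn, (resumeTape_injective p).eq_iff]
    · fin_cases i <;> exact hm
    · rintro rfl
      simpa [(resumeTape_false_ne i).symm] using ha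
  | write i b S h =>
    -- Both working tapes at once: `k` and `i` number the same tape, `k` among tapes `0, 1, 2` and
    -- `i` among the writable ones.
    have key : ∀ k : Fin 3, k.castSucc = i.succ →
        resumeInstr p (.write i b S) = .write (resumeTape p k) b (p, S) →
        ∃ d', ReflTransGen (FourStep (resumeProgram M)) ⟨(p, c.q), w, n, o, m⟩ d' ∧
          ResumeRel y p ⟨S, Function.update c.w i.succ
            (Function.update (c.w i.succ) (c.n i.succ) b),
            Function.update c.n i.succ (c.n i.succ + 1)⟩ d' := by
      intro k hk hI
      rw [← hk]
      have h3 : (3 : Fin 4) ≠ k.castSucc := (Fin.castSucc_lt_last k).ne'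
      refine ⟨_, .single (.write _ (resumeTape p k) b _ ((hp _ h).trans hI)), rfl,
        fun j => ?_, fun j => ?_, ?_, ?_, ?_⟩
      · by_cases hj : j = k
        · subst hj; simp [hn, hw]
        · simp [hj, hw, (resumeTape_injective p).eq_iff]
      · by_cases hj : j = k
        · subst hj; simp [hn]
        · simp [hj, hn, (resumeTape_injective p).eq_iff]
      · simpa [h3] using ho
      · simpa [h3] using hm
      · rintro rfl
        simpa [(resumeTape_false_ne k).symm] using ha
    match i, key with
    | 0, key => exact key 1 rfl rfl
    | 1, key => exact key 2 rfl rfl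
    | 2, _ =>
      refine ⟨_, .single (.out _ b (p, S) (hp _ h)), rfl, fun j => ?_, fun j => ?_, ?_, ?_, ha⟩
      · exact (hw j).trans (by fin_cases j <;> rfl)
      · exact (hn j).trans (by fin_cases j <;> rfl)
      · simp [ho, hm]
      · simp [hm]

/-- Nothing is copied: with the new phase, tape `3` takes over from tape `2`, and there the answer
is waiting with the head at `0`. -/
theorem resume_call {y : Cantor} {c : Config M.Q} {d : FourConfig (Bool × M.Q)}
    (h : ResumeRel y false c d) {S₀ S₁ : M.Q} (hq : M.instr c.q = .query S₀ S₁) :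
    ∃ d', ReflTransGen (FourStep (resumeProgram M)) d d' ∧
      ResumeRel y true (M.answerConfig c S₀ y) d' := by
  obtain ⟨_, w, n, o, m⟩ := d
  obtain ⟨hdq, hw, hn, ho, hm, ha⟩ := h
  dsimp only at hdq hw hn ho hm ha
  subst hdq
  have hp : resumeProgram M (false, c.q) = resumeInstr false (.query S₀ S₁) :=
    congrArg (resumeInstr false) hq
  obtain ⟨hwy, hn0⟩ := ha rfl
  refine ⟨_, .single (.test _ 0 _ hp), rfl, fun i => ?_, fun i => ?_, ho, hm, nofun⟩
  · fin_cases i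
    exacts [hw 0, hw 1, hwy]
  · fin_cases i
    exacts [hn 0, hn 1, hn0]

variable (M) in
/-- The machine that computes the output from the input and the answer of the oracle. -/
def resumeMachine : OracleMachine :=
  haveI := M.fin
  fourMachine false (resumeProgram M) (false, M.s)

/-- The call provided by `hx` fixes the query `z` and the answer `y` used in the replay. Any first
call met in the simulation has a value of `queryMachine` as its query, hence the same `z` and `y`; a
second call contradicts `hx`. -/
theorem mem_compose_of_mem_eval {φ : Cantor →. Cantor} {x v : Cantor}
    (hx : M.MakesSingleCall (MultiFun.ofPFun φ) x)
    (hv : v ∈ M.eval (MultiFun.ofPFun φ) 1 x) :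
    v ∈ compose (resumeMachine M).pfun φ (queryMachine M).pfun x := by
  have := M.fin
  obtain ⟨⟨_, hd⟩, hle⟩ := hx
  obtain ⟨d₀, S₀, S₁, z, y, hr, hi, hz, hy⟩ := hd.exists_call
  have hz' := mem_queryMachine_pfun hr hi hz
  refine Part.mem_bind hz' (Part.mem_bind hy (fourMachine_yields_pair ?_))
  refine OutputSystem.Yields.of_sim (A := M.system (M.OStep (MultiFun.ofPFun φ) 1))
    (B := fourSystem (resumeProgram M)) (fun c d =>
      (M.Run (MultiFun.ofPFun φ) 1 (M.init x) 0 c ∧ ResumeRel y false c d) ∨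
      (M.Run (MultiFun.ofPFun φ) 1 (M.init x) 1 c ∧ ResumeRel y true c d))
    ?_ ?_ ?_ ?_ (.inl ⟨.refl, rfl, ?_, ?_, rfl, rfl, fun _ => ⟨rfl, rfl⟩⟩) hv
  · intro c c' d h hs
    rcases OracleMachine.oStep_one_iff.1 hs with hs' | ⟨T₀, T₁, z', y', hi', hz₁, hy', rfl⟩
    · rcases h with ⟨hc, hR⟩ | ⟨hc, hR⟩
      · obtain ⟨d', hd', hR'⟩ := resume_step hR hs'
        exact ⟨d', hd', .inl ⟨hc.step hs'.not_query hs, hR'⟩⟩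
      · obtain ⟨d', hd', hR'⟩ := resume_step hR hs'
        exact ⟨d', hd', .inr ⟨hc.step hs'.not_query hs, hR'⟩⟩
    · rcases h with ⟨hc, hR⟩ | ⟨hc, hR⟩
      · obtain rfl := Part.mem_unique (mem_queryMachine_pfun hc hi' hz₁) hz'
        obtain rfl := Part.mem_unique hy' hy
        obtain ⟨d', hd', hR'⟩ := resume_call hR hi'
        exact ⟨d', hd', .inr ⟨hc.call ⟨_, _, hi'⟩ hs, hR'⟩⟩
      · exact absurd (hle _ _ (hc.call ⟨_, _, hi'⟩ hs)) (by decide)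
  · rintro c d h ha
    have hacc : ∀ p, d.q = (p, c.q) → resumeProgram M d.q = .accept := by
      rintro p hq
      rw [hq]
      exact congrArg (resumeInstr p) ha
    rcases h with ⟨-, hR⟩ | ⟨-, hR⟩ <;> exact hacc _ hR.q
  · rintro c d (⟨-, hR⟩ | ⟨-, hR⟩) <;> exact hR.o
  · rintro c d (⟨-, hR⟩ | ⟨-, hR⟩) <;> exact hR.m
  · intro i
    fin_cases i <;> rfl
  · intro i
    fin_cases i <;> rfl

end SingleCall

/-! ### From reductions to machines with a single oracle call -/

section Split

/-- The tape that contains the even (`false`) or odd (`true`) positions of the input. -/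
def splitTape : Bool → Fin 4
  | false => 0
  | true => 3

/-- The instructions of the four-tape program that simulates a machine, where the input is split
into its even and odd positions. The Boolean component of the state is the parity of the position
of the input head. The states `inr` move the head on the odd positions. -/
def splitInstr {Q : Type} (p : Bool) : Instr Q → FourInstr (Bool × Q ⊕ Bool × Q)
  | .start S => .test 0 fun _ => .inl (p, S)
  | .test 0 S => .test (splitTape p) fun b => .inl (p, S b)
  | .test i S => .test i.castSucc fun b => .inl (p, S b)
  -- The component heads move only when the simulated head passes from one pair of positions to
  -- another.
  | .left 0 S => if p then .test 0 fun _ => .inl (false, S) else .left 0 (.inr (true, S))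
  | .left i S => .left i.castSucc (.inl (p, S))
  | .right 0 S => if p then .right 0 (.inr (false, S)) else .test 0 fun _ => .inl (true, S)
  | .right i S => .right i.castSucc (.inl (p, S))
  | .write 0 b S => .write 1 b (.inl (p, S))
  | .write 1 b S => .write 2 b (.inl (p, S))
  | .write 2 b S => .out b (.inl (p, S))
  | .query _ _ => .reject
  | .accept => .accept
  | .reject => .reject

/-- The four-tape program that simulates a machine, where the input is split into its even and odd
positions. -/
def splitProgram (M : OracleMachine) : Bool × M.Q ⊕ Bool × M.Q → FourInstr (Bool × M.Q ⊕ Bool × M.Q)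
  | .inl (p, q) => splitInstr p (M.instr q)
  | .inr (false, S) => .right 3 (.inl (false, S))
  | .inr (true, S) => .left 3 (.inl (true, S))

/-- The configurations of the machine and of the four-tape program correspond. -/
structure SplitRel {M : OracleMachine} (x y : Cantor) (c : Config M.Q)
    (d : FourConfig (Bool × M.Q ⊕ Bool × M.Q)) : Prop where
  exists_parity : ∃ p : Bool, d.q = .inl (p, c.q) ∧ c.n 0 = 2 * d.n 0 + p.toNat
  w₀ : c.w 0 = pair x y
  dw₀ : d.w 0 = x
  dw₃ : d.w 3 = y
  dn₃ : d.n 3 = d.n 0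
  w₁ : d.w 1 = c.w 1
  w₂ : d.w 2 = c.w 2
  n₁ : d.n 1 = c.n 1
  n₂ : d.n 2 = c.n 2
  o : d.o = c.w 3
  m : d.m = c.n 3

variable {M : OracleMachine}

/-- Position `2 * j + p` of `pair x y` is position `j` of the component selected by the parity `p`.
Both component heads are kept at `j`. -/
theorem split_step {x y : Cantor} {c c' : Config M.Q} {d : FourConfig (Bool × M.Q ⊕ Bool × M.Q)}
    (h : SplitRel x y c d) (hs : M.Step c c') :
    ∃ d', ReflTransGen (FourStep (splitProgram M)) d d' ∧ SplitRel x y c' d' := by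
  obtain ⟨_, w, n, o, m⟩ := d
  obtain ⟨⟨p, hq, hn₀⟩, hw₀, dw₀, dw₃, dn₃, w₁, w₂, n₁, n₂, ho, hm⟩ := h
  dsimp only at hq hn₀ hw₀ dw₀ dw₃ dn₃ w₁ w₂ n₁ n₂ ho hm
  subst hq
  have hp : ∀ I, M.instr c.q = I → splitProgram M (.inl (p, c.q)) = splitInstr p I := by
    rintro _ rfl
    rfl
  cases hs with
  | start S h =>
    exact ⟨_, .single (.test _ 0 _ (hp _ h)), ⟨p, rfl, hn₀⟩, hw₀, dw₀, dw₃, dn₃, w₁, w₂, n₁, n₂,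
      ho, hm⟩
  | test i S h =>
    match i with
    | 0 =>
      refine ⟨_, .single (.test _ (splitTape p) _ (hp _ h)), ⟨p, ?_, hn₀⟩, hw₀, dw₀, dw₃, dn₃,
        w₁, w₂, n₁, n₂, ho, hm⟩
      have h₂ : (2 * n 0 + 1) / 2 = n 0 := by omega
      cases p <;> simp [splitTape, hw₀, hn₀, pair, dw₀, dw₃, dn₃, h₂]
    | 1 =>
      refine ⟨_, .single (.test _ 1 _ (hp _ h)), ⟨p, ?_, hn₀⟩, hw₀, dw₀, dw₃, dn₃,
        w₁, w₂, n₁, n₂, ho, hm⟩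
      simp [w₁, n₁]
    | 2 =>
      refine ⟨_, .single (.test _ 2 _ (hp _ h)), ⟨p, ?_, hn₀⟩, hw₀, dw₀, dw₃, dn₃,
        w₁, w₂, n₁, n₂, ho, hm⟩
      simp [w₂, n₂]
  | right i S h =>
    match i with
    | 0 =>
      cases p with
      | false =>
        refine ⟨_, .single (.test _ 0 _ (hp _ h)), ⟨true, rfl, ?_⟩, hw₀, dw₀, dw₃, dn₃,
          w₁, w₂, n₁, n₂, ho, hm⟩
        simp [hn₀]
      | true =>
        refine ⟨_, .head (.right _ 0 (Sum.inr (false, S)) (hp _ h)) (.single (.right _ 3 _ rfl)),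
          ⟨false, rfl, ?_⟩, hw₀, dw₀, dw₃, ?_, w₁, w₂, n₁, n₂, ho, hm⟩
        · simp [hn₀]
          ring
        · simp [dn₃]
    | 1 =>
      exact ⟨_, .single (.right _ 1 _ (hp _ h)), ⟨p, rfl, hn₀⟩, hw₀, dw₀, dw₃, dn₃, w₁, w₂,
        congrArg (· + 1) n₁, n₂, ho, hm⟩
    | 2 =>
      exact ⟨_, .single (.right _ 2 _ (hp _ h)), ⟨p, rfl, hn₀⟩, hw₀, dw₀, dw₃, dn₃, w₁, w₂,
        n₁, congrArg (· + 1) n₂, ho, hm⟩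
  | left i S h h0 =>
    match i with
    | 0 =>
      replace h0 : c.n 0 ≠ 0 := h0
      cases p with
      | false =>
        -- At even positions the component heads are at `0` exactly when the simulated head is, so
        -- both moves to the left are legal.
        have h1 : n 0 ≠ 0 := by
          rintro h1
          simp [h1] at hn₀
          exact h0 hn₀
        refine ⟨_, .head (.left _ 0 (Sum.inr (true, S)) (hp _ h) h1)
          (.single (.left _ 3 _ rfl (dn₃.trans_ne h1))),
          ⟨true, rfl, ?_⟩, hw₀, dw₀, dw₃, ?_, w₁, w₂, n₁, n₂, ho, hm⟩
        · simp [hn₀]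
          omega
        · simp [dn₃]
      | true =>
        refine ⟨_, .single (.test _ 0 _ (hp _ h)), ⟨false, rfl, ?_⟩, hw₀, dw₀, dw₃, dn₃,
          w₁, w₂, n₁, n₂, ho, hm⟩
        simp [hn₀]
    | 1 =>
      exact ⟨_, .single (.left _ 1 _ (hp _ h) (n₁.trans_ne h0)), ⟨p, rfl, hn₀⟩, hw₀, dw₀, dw₃,
        dn₃, w₁, w₂, congrArg (· - 1) n₁, n₂, ho, hm⟩
    | 2 =>
      exact ⟨_, .single (.left _ 2 _ (hp _ h) (n₂.trans_ne h0)), ⟨p, rfl, hn₀⟩, hw₀, dw₀, dw₃,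
        dn₃, w₁, w₂, n₁, congrArg (· - 1) n₂, ho, hm⟩
  | write i b S h =>
    match i with
    | 0 =>
      refine ⟨_, .single (.write _ 1 b _ (hp _ h)), ⟨p, rfl, hn₀⟩, hw₀, dw₀, dw₃, dn₃, ?_, w₂,
        congrArg (· + 1) n₁, n₂, ho, hm⟩
      simp [w₁, n₁]
    | 1 =>
      refine ⟨_, .single (.write _ 2 b _ (hp _ h)), ⟨p, rfl, hn₀⟩, hw₀, dw₀, dw₃, dn₃, w₁, ?_,
        n₁, congrArg (· + 1) n₂, ho, hm⟩
      simp [w₂, n₂]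
    | 2 =>
      refine ⟨_, .single (.out _ b _ (hp _ h)), ⟨p, rfl, hn₀⟩, hw₀, dw₀, dw₃, dn₃, w₁, w₂, n₁, n₂,
        ?_, congrArg (· + 1) hm⟩
      simp [ho, hm]

/-- A machine is simulated by a four-tape program on the two components of its input. -/
theorem split_yields {x y v : Cantor}
    (h : M.Yields (ReflTransGen M.Step) (M.init (pair x y)) v) :
    (fourSystem (splitProgram M)).Yields (.init (.inl (false, M.s)) x y) v := by
  refine OutputSystem.Yields.of_sim (A := M.system M.Step) (B := fourSystem (splitProgram M))
    (SplitRel x y) (fun _ _ _ => split_step) (fun c d hR ha => ?_) (fun _ _ hR => hR.o)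
    (fun _ _ hR => hR.m) ⟨⟨false, rfl, rfl⟩, rfl, rfl, rfl, rfl, rfl, rfl, rfl, rfl, rfl, rfl⟩ h
  obtain ⟨p, hq, -⟩ := hR.exists_parity
  change splitProgram M d.q = _
  rw [hq]
  exact congrArg (splitInstr p) ha

end Split

section Reduction

variable (F G : OracleMachine)

/-- The machine that computes the second argument of the input of `F` by an oracle call, with the
query computed by `G`. -/
def reductionTable : Option (G.Q ⊕ F.Q) → Instr (Option (G.Q ⊕ F.Q))
  | none => .query (some (.inr F.s)) (some (.inl G.s))
  | some (.inl q) => (G.instr q).embed fun q => some (.inl q)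
  | some (.inr q) => (F.instr q).embed fun q => some (.inr q)

/-- The machine that asks for the oracle's answer to the value of `G` and continues with `F`. -/
def reductionMachine : OracleMachine :=
  haveI := F.fin
  haveI := G.fin
  ofTable (reductionTable F G) none

variable {F G}

/-- The main run visits the copy of `G` only inside the call. After the call it stays in the copy of
`F`, where there are no queries. -/
theorem reductionMachine_run (hF : F.IsType2) {O : MultiFun} {x : Cantor} {k : ℕ}
    {c : Config (reductionMachine F G).Q}
    (h : (reductionMachine F G).Run O 1 ((reductionMachine F G).init x) k c) :
    (k = 0 ∧ (c.q = .source ∨ c.q = .node none)) ∨ (k = 1 ∧ ∃ q, c.q = .node (some (.inr q))) := by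
  have hinr : ∀ q, (reductionMachine F G).instr (.node (some (.inr q))) =
      (F.instr q).embed fun q => .node (some (.inr q)) := fun q => Instr.embed_embed _ _ _
  induction h with
  | refl => exact .inl ⟨rfl, .inl rfl⟩
  | @step k d e hr hq hs ih =>
    rcases OracleMachine.oStep_one_iff.1 hs with hs | ⟨S₀, S₁, _, _, hi, -⟩
    · have ht := hs.mem_targets
      rcases ih with ⟨rfl, hd | hd⟩ | ⟨rfl, q, hd⟩
      · rw [hd] at ht
        exact .inl ⟨rfl, .inr ht⟩
      · rw [hd] at hq
        exact absurd ⟨_, _, rfl⟩ hq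
      · rw [hd, hinr] at ht
        obtain ⟨q', hq'⟩ := Instr.targets_embed_subset _ _ ht
        exact .inr ⟨rfl, q', hq'.symm⟩
    · exact absurd ⟨_, _, hi⟩ hq
  | @call k d e hr hq hs ih =>
    rcases OracleMachine.oStep_one_iff.1 hs with hs | ⟨S₀, S₁, _, _, hi, -, -, rfl⟩
    · exact absurd hq hs.not_query
    · rcases ih with ⟨rfl, hd | hd⟩ | ⟨rfl, q, hd⟩
      · rw [hd] at hi
        exact nomatch hi
      · rw [hd] at hi
        cases hi
        exact .inr ⟨rfl, F.s, rfl⟩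
      · rw [hd, hinr] at hq
        exact absurd (Instr.isQuery_embed.1 hq) (hF q)

theorem reductionMachine_spec (hF : F.IsType2) {φ : Cantor →. Cantor}
    {x y z v : Cantor} (hz : z ∈ G.pfun x) (hy : y ∈ φ z)
    (hv : F.Yields (ReflTransGen F.Step) ⟨F.s, ![x, zeros, y, zeros], fun _ => 0⟩ v) :
    (reductionMachine F G).MakesSingleCall (MultiFun.ofPFun φ) x ∧
      v ∈ (reductionMachine F G).eval (MultiFun.ofPFun φ) 1 x := by
  set N := reductionMachine F G
  let c₁ : Config N.Q := ⟨.node none, (N.init x).w, (N.init x).n⟩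
  have h₁ : N.Step (N.init x) c₁ := .start _ _ rfl
  -- The call comes before anything is written, so the query computation starts exactly like `G` on
  -- `x`.
  have hquery : N.queryConfig c₁ (.node (some (.inl G.s))) =
      (G.init x).map fun q => Node.node (some (.inl q)) := by
    simp only [OracleMachine.queryConfig, Config.map, c₁, OracleMachine.init]
    congr 1 <;> funext j <;> fin_cases j <;> rfl
  have hz' : N.Yields (ReflTransGen N.Step)
      (N.queryConfig c₁ (.node (some (.inl G.s)))) z := by
    rw [hquery]
    exact OracleMachine.Yields.map (M := G) (M' := N) (e := fun q => .node (some (.inl q)))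
      (fun q _ => Instr.embed_embed _ _ _)
      (OracleMachine.mem_pfun.1 hz)
  have h₂ : N.OStep (MultiFun.ofPFun φ) 1 c₁ (N.answerConfig c₁ (.node (some (.inr F.s))) y) :=
    .inr ⟨_, _, z, y, rfl, hz', hy, rfl⟩
  have hanswer : N.answerConfig c₁ (.node (some (.inr F.s))) y =
      (⟨F.s, ![x, zeros, y, zeros], fun _ => 0⟩ : Config F.Q).map
        fun q => Node.node (some (.inr q)) := by
    simp only [OracleMachine.answerConfig, Config.map, c₁, OracleMachine.init]
    congr 1 <;> funext j <;> fin_cases j <;> rfl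
  refine ⟨⟨⟨_, .call (.step .refl ?_ (.inl h₁)) ⟨_, _, rfl⟩ h₂⟩, fun k d hd => ?_⟩, ?_⟩
  · rintro ⟨_, _, h⟩
    exact nomatch h
  · rcases reductionMachine_run hF hd with ⟨rfl, -⟩ | ⟨rfl, -⟩
    · exact Nat.zero_le 1
    · exact le_rfl
  · refine OutputSystem.Yields.of_reflTransGen (A := N.system (N.OStep (MultiFun.ofPFun φ) 1))
      (.head (.inl h₁) (.single h₂)) le_rfl ?_
    rw [hanswer]
    -- After the call `F` takes ordinary steps only, and these are oracle steps as well.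
    exact OutputSystem.Yields.of_sim (A := N.system N.Step)
      (B := N.system (N.OStep (MultiFun.ofPFun φ) 1)) Eq
      (by rintro c c' _ rfl hs; exact ⟨c', .single (.inl hs), rfl⟩)
      (by rintro c _ rfl ha; exact ha) (by rintro c _ rfl; rfl) (by rintro c _ rfl; rfl) rfl
      (OracleMachine.Yields.map (M := F) (M' := N) (e := fun q => .node (some (.inr q)))
        (fun q _ => Instr.embed_embed _ _ _) hv)

end Reduction

/-! ### Single calls and reducibility -/

/-- A machine that makes a single oracle call is a reduction, uniformly in the oracle. -/
theorem exists_reduction_of_machine (M : OracleMachine) :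
    ∃ F G : Cantor →. Cantor, ComputablePFun F ∧ ComputablePFun G ∧
      ∀ (φ : Cantor →. Cantor) (x v : Cantor), M.MakesSingleCall (MultiFun.ofPFun φ) x →
        v ∈ M.eval (MultiFun.ofPFun φ) 1 x → v ∈ compose F φ G x := by
  have := M.fin
  exact ⟨(resumeMachine M).pfun, (queryMachine M).pfun,
    OracleMachine.computablePFun_pfun (fourMachine_isType2 _ _ _),
    OracleMachine.computablePFun_pfun (queryMachine_isType2 M),
    fun φ x v => mem_compose_of_mem_eval⟩

/-- A reduction is a machine that makes a single oracle call, uniformly in the oracle. -/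
theorem exists_machine_of_reduction {F G : Cantor →. Cantor} (hF : ComputablePFun F)
    (hG : ComputablePFun G) :
    ∃ M : OracleMachine, ∀ (φ : Cantor →. Cantor) (x v : Cantor), v ∈ compose F φ G x →
      M.MakesSingleCall (MultiFun.ofPFun φ) x ∧ M.eval (MultiFun.ofPFun φ) 1 x = {v} := by
  obtain ⟨MF, -, hMF⟩ := hF
  obtain ⟨MG, -, hMG⟩ := hG
  have := MF.fin
  -- The machine for `F` reads `pair x y`; it is recast to take `y` from the second working tape,
  -- where the oracle leaves it.
  refine ⟨reductionMachine (fourMachine true (splitProgram MF) (.inl (false, MF.s))) MG,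
    fun φ x v hv => ?_⟩
  obtain ⟨z, hz, hv⟩ := Part.mem_bind_iff.1 hv
  obtain ⟨y, hy, hv⟩ := Part.mem_bind_iff.1 hv
  obtain ⟨h₁, h₂⟩ := reductionMachine_spec (fourMachine_isType2 _ _ _)
    (OracleMachine.mem_pfun.2 ((hMG _ _).1 hz)) hy
    (fourMachine_yields_answer (split_yields ((hMF _ _).1 hv)))
  exact ⟨h₁, Set.eq_singleton_iff_unique_mem.2
    ⟨h₂, fun _ hw => OracleMachine.eval_unique hw h₂⟩⟩

/-- The machine, respectively `F` and `G`, is fixed before the choice function, so each choice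
function can be treated separately. -/
theorem computableWithSingleCall_iff (f g : MultiFun) :
    ComputableWithSingleCall f g ↔ WeihrauchLE f g := by
  constructor
  · rintro ⟨M, hM⟩
    obtain ⟨F, G, hF, hG, h⟩ := exists_reduction_of_machine M
    refine ⟨F, G, hF, hG, fun φ hφ x hx => ?_⟩
    obtain ⟨hc, ⟨v, hv⟩, hsub⟩ := hM φ hφ x hx
    exact ⟨v, h φ x v hc hv, hsub hv⟩
  · rintro ⟨F, G, hF, hG, h⟩
    obtain ⟨M, hM⟩ := exists_machine_of_reduction hF hG
    refine ⟨M, fun φ hφ x hx => ?_⟩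
    obtain ⟨v, hv, hvf⟩ := h φ hφ x hx
    obtain ⟨hc, he⟩ := hM φ x v hv
    rw [he]
    exact ⟨hc, Set.singleton_nonempty v, Set.singleton_subset_iff.2 hvf⟩

theorem computableWithSingleCallFun_iff (f g : Cantor →. Cantor) :
    ComputableWithSingleCallFun f g ↔ WeihrauchLEFun f g := by
  constructor
  · rintro ⟨M, hM⟩
    obtain ⟨F, G, hF, hG, h⟩ := exists_reduction_of_machine M
    refine ⟨F, G, hF, hG, fun x hx => ?_⟩
    obtain ⟨hc, ⟨v, hv⟩, hsub⟩ := hM x ⟨(f x).get hx, Part.get_mem hx⟩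
    have hvf : v ∈ f x := hsub hv
    -- Two partial values with the common element `v` are equal.
    rw [Part.eq_some_iff.2 hvf, Part.eq_some_iff.2 (h g x v hc hv)]
  · rintro ⟨F, G, hF, hG, h⟩
    obtain ⟨M, hM⟩ := exists_machine_of_reduction hF hG
    refine ⟨M, fun x ⟨v, hv⟩ => ?_⟩
    have hvf : v ∈ f x := hv
    obtain ⟨hc, he⟩ := hM g x v (h x (Part.dom_iff_mem.2 ⟨v, hvf⟩) ▸ hvf)
    rw [he]
    exact ⟨hc, Set.singleton_nonempty v, Set.singleton_subset_iff.2 hv⟩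

end TypeTwo

theorem theorem5 :
    (∀ f g : TypeTwo.MultiFun,
      TypeTwo.ComputableWithSingleCall f g ↔ TypeTwo.WeihrauchLE f g) ∧
    (∀ f g : TypeTwo.Cantor →. TypeTwo.Cantor,
      TypeTwo.ComputableWithSingleCallFun f g ↔ TypeTwo.WeihrauchLEFun f g) :=
  ⟨TypeTwo.computableWithSingleCall_iff, TypeTwo.computableWithSingleCallFun_iff⟩
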